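/- Let $\alpha,\beta,\gamma>-1$ and $\sigma>0$. For $a,b>-1$ let $w_{a,b}(x)=x^{a}(1-x)^{b}$ on $[0,1]$, $c_{a,b}=\big(\int_0^1 w_{a,b}(x)\,dx\big)^{-1}$, and $\|g\|_{L^2(w_{a,b})}=\big(\int_0^1|g|^2w_{a,b}\,dx\big)^{1/2}$. Let $P_n^{(a,b)}$ denote the usual Jacobi polynomial of degree $n$ on $[-1,1]$, so that $P_n^{(b,a)}(2x-1)$ is orthogonal with respect to $w_{a,b}$ on $[0,1]$; put $h_n^{a,b}=c_{a,b}\int_0^1[P_n^{(b,a)}(2x-1)]^2w_{a,b}(x)\,dx$, and let $s_n^{a,b}g$ be the partial sum up to degree $n$ (terms $k=0,\dots,n$) of the Fourier–Jacobi series of $g\in L^2(w_{a,b})$ in the polynomials $P_k^{(b,a)}(2x-1)$. Write $(a)_n=a(a+1)\cdots(a+n-1)$. On the wedge $\Omega=\{(x,1):x\in[0,1]\}\cup\{(1,y):y\in[0,1]\}$ let $$\langle f,g\rangle=c_{\alpha,\gamma}\int_0^1 f(x,1)g(x,1)w_{\alpha,\gamma}(x)\,dx+\sigma c_{\beta,\gamma}\int_0^1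 f(1,y)g(1,y)w_{\beta,\gamma}(y)\,dy,\qquad \|f\|=\langle f,f\rangle^{1/2},$$ and let $L^2(\Omega,w_{\alpha,\gamma},w_{\beta,\gamma})$ be the space of real-valued functions $f$ on $\Omega$ with a finite value $f(1,1)$ such that $f(\cdot,1)\in L^2(w_{\alpha,\gamma})$ and $f(1,\cdot)\in L^2(w_{\beta,\gamma})$. For $n\ge1$ define $$P_n(x,y)=P_n^{(\gamma,\alpha)}(2x-1)+P_n^{(\gamma,\beta)}(2y-1)-\binom{n+\gamma}{n},$$ $$Q_n(x,y)=\frac{(\gamma+\alpha+2)_n}{(\alpha+1)_{n-1}}(1-x)P_{n-1}^{(\gamma+2,\alpha)}(2x-1)-\sigma^{-1}\frac{(\gamma+\beta+2)_n}{(\beta+1)_{n-1}}(1-y)P_{n-1}^{(\gamma+2,\beta)}(2y-1),$$ $$R_n=Q_n-\frac{\langle P_n,Q_n\rangle}{h_n^{\alpha,\gamma}+\sigma h_n^{\beta,\gamma}}\,P_n,$$ and, for $n\ge0$, $$S_nf=\frac{\langle f,1\rangle}{\langle1,1\rangle}+\sum_{k=1}^n\left[\frac{\langle f,P_k\rangle}{\langle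 P_k,P_k\rangle}P_k+\frac{\langle f,R_k\rangle}{\langle R_k,R_k\rangle}R_k\right].$$ Then for every $f\in L^2(\Omega,w_{\alpha,\gamma},w_{\beta,\gamma})$ the Fourier orthogonal expansion converges to $f$ in norm: $\|f-S_nf\|\to0$ as $n\to\infty$. Furthermore, there is a constant $c>0$ depending only on $\alpha,\beta,\gamma$ and the fixed parameter $\sigma$ such that, for every $f\in L^2(\Omega,w_{\alpha,\gamma},w_{\beta,\gamma})$ and every $n\ge0$, $$\|f-S_nf\|\le c\left(\|f_1-s_n^{\alpha,\gamma}f_1\|_{L^2(w_{\alpha,\gamma})}+\|f_2-s_n^{\beta,\gamma}f_2\|_{L^2(w_{\beta,\gamma})}\right)+c\left(\|g_1-s_n^{\alpha,\gamma+2}g_1\|_{L^2(w_{\alpha,\gamma+2})}+\|g_2-s_n^{\beta,\gamma+2}g_2\|_{L^2(w_{\beta,\gamma+2})}\right),$$ where $f_1(x)=f(x,1)$, $f_2(y)=f(1,y)$, $g_1(x)=\dfrac{f(x,1)-f(1,1)}{1-x}$ and $g_2(y)=\dfrac{f(1,y)-f(1,1)}{1-y}$. -/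

import Mathlib

open MeasureTheory Filter Topology

noncomputable section

namespace Wedge

/-- The Jacobi weight `w_{α,γ}(x) = x ^ α (1 - x) ^ γ` on `[0,1]`. -/
def jacobiWeight (α γ x : ℝ) : ℝ := x ^ α * (1 - x) ^ γ

/-- The measure `w_{α,γ}(x) dx` on `[0,1]`. -/
def jacobiMeasure (α γ : ℝ) : Measure ℝ :=
  (volume.restrict (Set.Icc (0 : ℝ) 1)).withDensity
    fun x => ENNReal.ofReal (jacobiWeight α γ x)

/-- Integration against `jacobiMeasure α γ` is the weighted integral
`∫₀¹ f(x) w_{α,γ}(x) dx`. -/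
theorem integral_jacobiMeasure (α γ : ℝ) (f : ℝ → ℝ) :
    ∫ x, f x ∂jacobiMeasure α γ = ∫ x in (0 : ℝ)..1, f x * jacobiWeight α γ x := by
  have hm : Measurable (jacobiWeight α γ) := by
    unfold jacobiWeight
    fun_prop
  have h := integral_withDensity_eq_integral_toReal_smul
    (μ := volume.restrict (Set.Icc (0 : ℝ) 1))
    (f := fun x => ENNReal.ofReal (jacobiWeight α γ x)) hm.ennreal_ofReal
    (Eventually.of_forall fun x => ENNReal.ofReal_lt_top) f
  rw [jacobiMeasure, h, intervalIntegral.integral_of_le zero_le_one,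
    ← integral_Icc_eq_integral_Ioc]
  refine setIntegral_congr_fun measurableSet_Icc fun x hx => ?_
  have h0 : 0 ≤ jacobiWeight α γ x :=
    mul_nonneg (Real.rpow_nonneg hx.1 _) (Real.rpow_nonneg (sub_nonneg.2 hx.2) _)
  simp only [ENNReal.toReal_ofReal h0, smul_eq_mul, mul_comm]

/-- The normalization constant `c_{α,γ} = (∫₀¹ w_{α,γ}(x) dx)⁻¹`. -/
def jacobiConst (α γ : ℝ) : ℝ := (∫ x in (0 : ℝ)..1, jacobiWeight α γ x)⁻¹

/-- The rising factorial (Pochhammer symbol) `(a)_n = a (a + 1) ⋯ (a + n - 1)`. -/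
def poch (a : ℝ) (n : ℕ) : ℝ := (ascPochhammer ℝ n).eval a

/-- The Jacobi polynomial `P_n^{(a,b)}` on `[-1,1]`, with the usual normalization
`P_n^{(a,b)}(1) = (a+1)_n / n!`, through its explicit expansion at `t = 1`:
`P_n^{(a,b)}(t) = ∑_{k ≤ n} (n+a+b+1)_k (a+k+1)_{n-k} / (k! (n-k)!) ((t-1)/2)^k`. -/
def jacobiP (a b : ℝ) (n : ℕ) (t : ℝ) : ℝ :=
  ∑ k ∈ Finset.range (n + 1),
    poch (n + a + b + 1) k * poch (a + k + 1) (n - k) /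
      ((k.factorial : ℝ) * ((n - k).factorial : ℝ)) * ((t - 1) / 2) ^ k

/-- The polynomial `x ↦ P_n^{(γ,α)}(2x - 1)`, the orthogonal polynomial of degree `n` for the
weight `w_{α,γ}` on `[0,1]`. -/
def shiftedJacobi (α γ : ℝ) (n : ℕ) (x : ℝ) : ℝ := jacobiP γ α n (2 * x - 1)

/-- `h_n^{α,γ} = c_{α,γ} ∫₀¹ [P_n^{(γ,α)}(2x - 1)]² w_{α,γ}(x) dx`. -/
def jacobiNormSq (α γ : ℝ) (n : ℕ) : ℝ :=
  jacobiConst α γ * ∫ x, shiftedJacobi α γ n x ^ 2 ∂jacobiMeasure α γ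

/-- The `L²(w_{α,γ})` norm `(∫₀¹ |g(x)|² w_{α,γ}(x) dx)^{1/2}`. -/
def jacobiL2Norm (α γ : ℝ) (g : ℝ → ℝ) : ℝ :=
  Real.sqrt (∫ x, |g x| ^ 2 ∂jacobiMeasure α γ)

/-- The `n`-th Fourier--Jacobi coefficient of `g` for the weight `w_{α,γ}`. -/
def jacobiCoeff (α γ : ℝ) (g : ℝ → ℝ) (n : ℕ) : ℝ :=
  (∫ x, g x * shiftedJacobi α γ n x ∂jacobiMeasure α γ) /
    ∫ x, shiftedJacobi α γ n x ^ 2 ∂jacobiMeasure α γ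

/-- The `n`-th partial sum `s_n^{α,γ} g` of the Fourier--Jacobi series of `g`. -/
def jacobiPartialSum (α γ : ℝ) (n : ℕ) (g : ℝ → ℝ) (x : ℝ) : ℝ :=
  ∑ k ∈ Finset.range (n + 1), jacobiCoeff α γ g k * shiftedJacobi α γ k x

/-! Functions on the wedge `Ω = {(x,1) : x ∈ [0,1]} ∪ {(1,y) : y ∈ [0,1]}` are represented by
functions of two real variables; only the values on `Ω` are used below. -/

/-- The inner product `⟨f, g⟩_{α,β,γ}` on the wedge, with parameter `σ`. -/
def inner (α β γ σ : ℝ) (f g : ℝ → ℝ → ℝ) : ℝ :=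
  jacobiConst α γ * (∫ x, f x 1 * g x 1 ∂jacobiMeasure α γ) +
    σ * jacobiConst β γ * ∫ y, f 1 y * g 1 y ∂jacobiMeasure β γ

/-- The norm of `L²(Ω, w_{α,γ}, w_{β,γ})`. -/
def norm (α β γ σ : ℝ) (f : ℝ → ℝ → ℝ) : ℝ :=
  Real.sqrt (jacobiConst α γ * (∫ x, |f x 1| ^ 2 ∂jacobiMeasure α γ) +
    σ * jacobiConst β γ * ∫ y, |f 1 y| ^ 2 ∂jacobiMeasure β γ)

/-- Membership in `L²(Ω, w_{α,γ}, w_{β,γ})`: both restrictions are measurable and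
square-integrable for their weights. (The value `f 1 1` is a real number, hence finite.) -/
def MemL2 (α β γ : ℝ) (f : ℝ → ℝ → ℝ) : Prop :=
  MemLp (fun x => f x 1) 2 (jacobiMeasure α γ) ∧ MemLp (fun y => f 1 y) 2 (jacobiMeasure β γ)

/-- `P_n(x,y) = P_n^{(γ,α)}(2x-1) + P_n^{(γ,β)}(2y-1) - binom(n+γ, n)`, where the generalized
binomial coefficient is `(γ+1)_n / n!`. For `n = 0` this is the constant `1`. -/
def P (α β γ : ℝ) (n : ℕ) (x y : ℝ) : ℝ :=
  shiftedJacobi α γ n x + shiftedJacobi β γ n y - poch (γ + 1) n / (n.factorial : ℝ)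

/-- The polynomials `Q_n`, for `n ≥ 1` (the value at `n = 0` is not used). -/
def Q (α β γ σ : ℝ) (n : ℕ) (x y : ℝ) : ℝ :=
  poch (γ + α + 2) n / poch (α + 1) (n - 1) *
      ((1 - x) * shiftedJacobi α (γ + 2) (n - 1) x) -
    σ⁻¹ * (poch (γ + β + 2) n / poch (β + 1) (n - 1)) *
      ((1 - y) * shiftedJacobi β (γ + 2) (n - 1) y)

/-- The polynomials `R_n = Q_n - ⟨P_n, Q_n⟩ / (h_n^{α,γ} + σ h_n^{β,γ}) P_n`, for `n ≥ 1`. -/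
def R (α β γ σ : ℝ) (n : ℕ) (x y : ℝ) : ℝ :=
  Q α β γ σ n x y -
    inner α β γ σ (P α β γ n) (Q α β γ σ n) /
      (jacobiNormSq α γ n + σ * jacobiNormSq β γ n) * P α β γ n x y

/-- The Fourier coefficient `⟨f, p⟩ / ⟨p, p⟩`. -/
def coeff (α β γ σ : ℝ) (f p : ℝ → ℝ → ℝ) : ℝ :=
  inner α β γ σ f p / inner α β γ σ p p

/-- The partial sum
`S_n f = ⟨f,1⟩/⟨1,1⟩ + ∑_{k=1}^n (⟨f,P_k⟩/⟨P_k,P_k⟩ P_k + ⟨f,R_k⟩/⟨R_k,R_k⟩ R_k)`. -/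
def partialSum (α β γ σ : ℝ) (n : ℕ) (f : ℝ → ℝ → ℝ) (x y : ℝ) : ℝ :=
  coeff α β γ σ f (fun _ _ => 1) +
    ∑ k ∈ Finset.Icc 1 n,
      (coeff α β γ σ f (P α β γ k) * P α β γ k x y +
        coeff α β γ σ f (R α β γ σ k) * R α β γ σ k x y)

/-- The restriction `f₁(x) = f(x,1)`. -/
def f₁ (f : ℝ → ℝ → ℝ) (x : ℝ) : ℝ := f x 1

/-- The restriction `f₂(y) = f(1,y)`. -/
def f₂ (f : ℝ → ℝ → ℝ) (y : ℝ) : ℝ := f 1 y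

/-- The difference quotient `g₁(x) = (f(x,1) - f(1,1)) / (1 - x)`. -/
def g₁ (f : ℝ → ℝ → ℝ) (x : ℝ) : ℝ := (f x 1 - f 1 1) / (1 - x)

/-- The difference quotient `g₂(y) = (f(1,y) - f(1,1)) / (1 - y)`. -/
def g₂ (f : ℝ → ℝ → ℝ) (y : ℝ) : ℝ := (f 1 y - f 1 1) / (1 - y)

/-- The error `‖g - s_n^{α,γ} g‖_{L²(w_{α,γ})}` of the Fourier--Jacobi series of `g`. -/
def jacobiError (α γ : ℝ) (n : ℕ) (g : ℝ → ℝ) : ℝ :=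
  jacobiL2Norm α γ fun x => g x - jacobiPartialSum α γ n g x

end Wedge

end

noncomputable section

namespace Wedge

/-! A function on the wedge is treated as a pair of functions on the two edges. The polynomials `1`,
`P_k`, `R_k` with `k ≤ n` restrict to an orthogonal basis of the pairs `(p, q)` of polynomials of
degree at most `n` with `p(1) = q(1)`, so `S_n f` is the best approximation to `f` from these pairs
(`edgeSystem_orthogonal`, `evalPair_mem_span`, `norm_sub_partialSum_sq_le`). It therefore suffices
to exhibit one good pair.

On each edge the trial polynomial is `f(1,1) + (1 - x) s_{n-1} g`, with the partial sum taken for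
the weight with exponent `γ + 2`. Both edges take the value `f(1,1)` at `1`, and multiplication by
`1 - x` is an isometry from `L²(w_{α,γ+2})` to `L²(w_{α,γ})`, so the error is that of `s_{n-1} g`.

The theorem asks for `s_n g`, so the missing term, with coefficient `G` of degree `n`, must be
bounded. Adding it gives a polynomial `T` of degree at most `n + 1` with error `ε`, the error of
`s_n g`; the polynomial `s_n f` has degree at most `n` and error `δ`. The coefficient of degree `n +
1` in `T - s_n f` is `G` up to sign and a known factor, and pairing with the Jacobi polynomial of
degree `n + 1` bounds it by the norm of `T - s_n f`, hence by `δ` and `ε`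
(`jacobiInner_sub_trialPoly_le`). The resulting constant is uniform in `n` by
`jacobiMass_mul_jacobiLead_le`.

Norm convergence follows from the estimate and the completeness of Jacobi polynomials, since the
difference quotients lie in `L²` of the weights with exponent `γ + 2`. All Jacobi facts come from
one integral, `integral_shiftedJacobi`, obtained by a Rodrigues-type recursion and integration by
parts. -/

/-! ### Jacobi weights as finite measures, and shifts of their exponents. -/

theorem measurable_jacobiWeight (α γ : ℝ) : Measurable (jacobiWeight α γ) := by
  unfold jacobiWeight
  fun_prop

theorem ae_mem_Ioo_jacobiMeasure (α γ : ℝ) :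
    ∀ᵐ x ∂jacobiMeasure α γ, x ∈ Set.Ioo (0 : ℝ) 1 := by
  have h : ∀ᵐ x ∂(volume.restrict (Set.Icc (0 : ℝ) 1)), x ∈ Set.Ioo (0 : ℝ) 1 := by
    rw [← restrict_Ioo_eq_restrict_Icc]
    exact ae_restrict_mem measurableSet_Ioo
  exact (withDensity_absolutelyContinuous _ _).ae_le h

theorem integrableOn_jacobiWeight {α γ : ℝ} (hα : -1 < α) (hγ : -1 < γ) :
    IntegrableOn (jacobiWeight α γ) (Set.Icc (0 : ℝ) 1) := by
  -- On the left half only the factor `x ^ a` can be singular; the right half follows by the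
  -- reflection `x ↦ 1 - x`.
  have left : ∀ {a : ℝ} (b : ℝ), -1 < a →
      IntervalIntegrable (fun x : ℝ => x ^ a * (1 - x) ^ b) volume 0 (1 / 2) := by
    intro a b ha
    refine (intervalIntegral.intervalIntegrable_rpow' ha).mul_continuousOn ?_
    intro x hx
    rw [Set.uIcc_of_le (by norm_num)] at hx
    refine ContinuousAt.continuousWithinAt ?_
    exact ContinuousAt.rpow_const (by fun_prop) (Or.inl (by linarith [hx.2]))
  have right : IntervalIntegrable (fun x : ℝ => x ^ α * (1 - x) ^ γ) volume (1 / 2) 1 := by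
    have h := ((left (a := γ) α hγ).comp_sub_left 1).symm
    norm_num at h
    norm_num
    exact h.congr (fun x _ => mul_comm _ _)
  have h := (left γ hα).trans right
  rwa [intervalIntegrable_iff_integrableOn_Icc_of_le zero_le_one] at h

theorem isFiniteMeasure_jacobiMeasure {α γ : ℝ} (hα : -1 < α) (hγ : -1 < γ) :
    IsFiniteMeasure (jacobiMeasure α γ) :=
  isFiniteMeasure_withDensity_ofReal (integrableOn_jacobiWeight hα hγ).2

/-- This lets integer powers of `x` and `1 - x` pass between integrand and weight, which is how the
exponents `γ`, `γ + 1` and `γ + 2` are related throughout. -/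
theorem jacobiMeasure_add (α γ : ℝ) (i j : ℕ) :
    jacobiMeasure (α + i) (γ + j) =
      (jacobiMeasure α γ).withDensity fun x => ENNReal.ofReal (x ^ i * (1 - x) ^ j) := by
  rw [jacobiMeasure, jacobiMeasure, ← withDensity_mul _ (measurable_jacobiWeight α γ).ennreal_ofReal
    (by fun_prop)]
  refine withDensity_congr_ae ?_
  rw [← restrict_Ioo_eq_restrict_Icc]
  filter_upwards [ae_restrict_mem measurableSet_Ioo] with x hx
  have h0 : 0 < x := hx.1
  have h1 : 0 < 1 - x := sub_pos.2 hx.2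
  rw [Pi.mul_apply, ← ENNReal.ofReal_mul (by unfold jacobiWeight; positivity), jacobiWeight,
    jacobiWeight, Real.rpow_add_natCast h0.ne', Real.rpow_add_natCast h1.ne']
  congr 1
  ring

theorem integral_jacobiMeasure_add (α γ : ℝ) (i j : ℕ) (f : ℝ → ℝ) :
    ∫ x, f x ∂jacobiMeasure (α + i) (γ + j) =
      ∫ x, x ^ i * (1 - x) ^ j * f x ∂jacobiMeasure α γ := by
  rw [jacobiMeasure_add, integral_withDensity_eq_integral_toReal_smul (by fun_prop)
    (Eventually.of_forall fun x => ENNReal.ofReal_lt_top)]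
  refine integral_congr_ae ?_
  filter_upwards [ae_mem_Ioo_jacobiMeasure α γ] with x hx
  have h0 : 0 < x := hx.1
  have h1 : 0 < 1 - x := sub_pos.2 hx.2
  rw [ENNReal.toReal_ofReal (by positivity), smul_eq_mul]

theorem memLp_jacobiMeasure_of_continuous {α γ : ℝ} (hα : -1 < α) (hγ : -1 < γ) {f : ℝ → ℝ}
    (hf : Continuous f) (p : ENNReal) : MemLp f p (jacobiMeasure α γ) := by
  have := isFiniteMeasure_jacobiMeasure hα hγ
  obtain ⟨C, hC⟩ := isCompact_Icc.exists_bound_of_continuousOn (s := Set.Icc (0 : ℝ) 1)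
    hf.continuousOn
  refine MemLp.of_bound hf.aestronglyMeasurable C ?_
  filter_upwards [ae_mem_Ioo_jacobiMeasure α γ] with x hx using hC x ⟨hx.1.le, hx.2.le⟩

theorem integrable_jacobiMeasure_of_continuous {α γ : ℝ} (hα : -1 < α) (hγ : -1 < γ) {f : ℝ → ℝ}
    (hf : Continuous f) : Integrable f (jacobiMeasure α γ) :=
  memLp_one_iff_integrable.1 (memLp_jacobiMeasure_of_continuous hα hγ hf 1)

/-- The difference quotient at `1` of a function in `L²(w_{α,γ})` belongs to `L²(w_{α,γ+2})`. -/
theorem memLp_div_one_sub {α γ : ℝ} {f : ℝ → ℝ} (hf : MemLp f 2 (jacobiMeasure α γ)) :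
    MemLp (fun x => f x / (1 - x)) 2 (jacobiMeasure α (γ + 2)) := by
  have e : jacobiMeasure α (γ + 2) =
      (jacobiMeasure α γ).withDensity fun x => ENNReal.ofReal ((1 - x) ^ 2) := by
    simpa using jacobiMeasure_add α γ 0 2
  have hm : AEStronglyMeasurable (fun x => f x / (1 - x)) (jacobiMeasure α (γ + 2)) := by
    rw [e]
    have h : AEMeasurable f (jacobiMeasure α γ) := hf.1.aemeasurable
    have h' : AEMeasurable (fun x => f x / (1 - x)) (jacobiMeasure α γ) :=
      h.div (by fun_prop)
    exact h'.aestronglyMeasurable.mono_ac (withDensity_absolutelyContinuous _ _)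
  rw [memLp_two_iff_integrable_sq hm, e,
    integrable_withDensity_iff_integrable_smul' (by fun_prop)
    (Eventually.of_forall fun x => ENNReal.ofReal_lt_top)]
  refine hf.integrable_sq.congr ?_
  filter_upwards [ae_mem_Ioo_jacobiMeasure α γ] with x hx
  have h1 : 1 - x ≠ 0 := (sub_pos.2 hx.2).ne'
  rw [ENNReal.toReal_ofReal (by positivity), smul_eq_mul]
  field_simp

/-! ### Masses of the weights and integration by parts. -/

/-- The total mass of the weight `w_{α,γ}`. -/
def jacobiMass (α γ : ℝ) : ℝ := ∫ _x, (1 : ℝ) ∂jacobiMeasure α γ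

theorem jacobiConst_eq (α γ : ℝ) : jacobiConst α γ = (jacobiMass α γ)⁻¹ := by
  rw [jacobiConst, jacobiMass, integral_jacobiMeasure]
  simp

theorem jacobiMass_pos {α γ : ℝ} (hα : -1 < α) (hγ : -1 < γ) : 0 < jacobiMass α γ := by
  have h := integrableOn_jacobiWeight hα hγ
  rw [jacobiMass, integral_jacobiMeasure]
  refine intervalIntegral.intervalIntegral_pos_of_pos_on ?_ ?_ one_pos
  · rw [intervalIntegrable_iff_integrableOn_Icc_of_le zero_le_one]
    simpa using h
  · intro x hx
    have h0 : 0 < x := hx.1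
    have h1 : 0 < 1 - x := sub_pos.2 hx.2
    unfold jacobiWeight
    positivity

theorem jacobiConst_pos {α γ : ℝ} (hα : -1 < α) (hγ : -1 < γ) : 0 < jacobiConst α γ := by
  rw [jacobiConst_eq]
  exact inv_pos.2 (jacobiMass_pos hα hγ)

/-- Integration by parts: the derivative of `q(x) x^{α+1} (1-x)^{γ+1}` has integral zero. -/
theorem integral_jacobiMeasure_deriv {α γ : ℝ} (hα : -1 < α) (hγ : -1 < γ)
    (q : Polynomial ℝ) :
    ∫ x, (q.derivative.eval x * (x * (1 - x)) +
      q.eval x * ((α + 1) * (1 - x) - (γ + 1) * x)) ∂jacobiMeasure α γ = 0 := by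
  have hint : IntervalIntegrable (fun x => (q.derivative.eval x * (x * (1 - x)) +
      q.eval x * ((α + 1) * (1 - x) - (γ + 1) * x)) * jacobiWeight α γ x) volume 0 1 := by
    refine IntervalIntegrable.continuousOn_mul ?_ (by fun_prop)
    rw [intervalIntegrable_iff_integrableOn_Icc_of_le zero_le_one]
    exact integrableOn_jacobiWeight hα hγ
  have hc : ContinuousOn (fun x : ℝ => q.eval x * (x ^ (α + 1) * (1 - x) ^ (γ + 1)))
      (Set.Icc 0 1) := by
    refine Continuous.continuousOn ?_
    exact q.continuous.mul ((continuous_id.rpow_const fun _ => Or.inr (by linarith)).mul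
      ((continuous_const.sub continuous_id).rpow_const fun _ => Or.inr (by linarith)))
  rw [integral_jacobiMeasure, intervalIntegral.integral_eq_sub_of_hasDerivAt_of_le zero_le_one hc
    ?_ hint]
  · simp [Real.zero_rpow (by linarith : α + 1 ≠ 0), Real.zero_rpow (by linarith : γ + 1 ≠ 0)]
  · intro x hx
    have h0 : 0 < x := hx.1
    have h1 : 0 < 1 - x := sub_pos.2 hx.2
    have d1 := (hasDerivAt_id x).rpow_const (p := α + 1) (Or.inl h0.ne')
    have d2 := ((hasDerivAt_id x).const_sub 1).rpow_const (p := γ + 1) (Or.inl h1.ne')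
    convert! (q.hasDerivAt x).mul (d1.mul d2) using 1
    simp only [id, jacobiWeight, add_sub_cancel_right, Real.rpow_add_one h0.ne',
      Real.rpow_add_one h1.ne', Pi.mul_apply]
    ring

/-- Integration by parts with `q = 1`. Together with `jacobiMass_add` it determines both shifted
masses, so Beta function values are not needed. -/
theorem jacobiMass_succ_right_eq {α γ : ℝ} (hα : -1 < α) (hγ : -1 < γ) :
    (α + 1) * jacobiMass α (γ + 1) = (γ + 1) * jacobiMass (α + 1) γ := by
  have h := integral_jacobiMeasure_deriv hα hγ 1
  have i1 : Integrable (fun x : ℝ => (α + 1) * (1 - x)) (jacobiMeasure α γ) :=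
    integrable_jacobiMeasure_of_continuous hα hγ (by fun_prop)
  have i2 : Integrable (fun x : ℝ => (γ + 1) * x) (jacobiMeasure α γ) :=
    integrable_jacobiMeasure_of_continuous hα hγ (by fun_prop)
  have e1 : jacobiMass α (γ + 1) = ∫ x, (1 - x) ∂jacobiMeasure α γ := by
    simpa [jacobiMass] using integral_jacobiMeasure_add α γ 0 1 (fun _ => 1)
  have e2 : jacobiMass (α + 1) γ = ∫ x, x ∂jacobiMeasure α γ := by
    simpa [jacobiMass] using integral_jacobiMeasure_add α γ 1 0 (fun _ => 1)
  simp only [Polynomial.derivative_one, Polynomial.eval_zero, zero_mul, Polynomial.eval_one,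
    one_mul, zero_add] at h
  rw [integral_sub i1 i2, integral_const_mul, integral_const_mul, ← e1, ← e2] at h
  linarith

theorem jacobiMass_add {α γ : ℝ} (hα : -1 < α) (hγ : -1 < γ) :
    jacobiMass (α + 1) γ + jacobiMass α (γ + 1) = jacobiMass α γ := by
  have e1 : jacobiMass α (γ + 1) = ∫ x, (1 - x) ∂jacobiMeasure α γ := by
    simpa [jacobiMass] using integral_jacobiMeasure_add α γ 0 1 (fun _ => 1)
  have e2 : jacobiMass (α + 1) γ = ∫ x, x ∂jacobiMeasure α γ := by
    simpa [jacobiMass] using integral_jacobiMeasure_add α γ 1 0 (fun _ => 1)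
  rw [e1, e2, ← integral_add (integrable_jacobiMeasure_of_continuous hα hγ (by fun_prop))
    (integrable_jacobiMeasure_of_continuous hα hγ (by fun_prop))]
  simp [jacobiMass]

theorem jacobiMass_succ_left {α γ : ℝ} (hα : -1 < α) (hγ : -1 < γ) :
    (α + γ + 2) * jacobiMass (α + 1) γ = (α + 1) * jacobiMass α γ := by
  rw [← jacobiMass_add hα hγ]
  linarith [jacobiMass_succ_right_eq hα hγ]

theorem jacobiMass_succ_right {α γ : ℝ} (hα : -1 < α) (hγ : -1 < γ) :
    (α + γ + 2) * jacobiMass α (γ + 1) = (γ + 1) * jacobiMass α γ := by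
  rw [← jacobiMass_add hα hγ]
  linarith [jacobiMass_succ_right_eq hα hγ]

/-! ### Pochhammer symbols and the Jacobi polynomials as polynomials. -/

theorem poch_zero (a : ℝ) : poch a 0 = 1 := by simp [poch]

theorem poch_succ_right (a : ℝ) (n : ℕ) : poch a (n + 1) = poch a n * (a + n) :=
  ascPochhammer_succ_eval n a

theorem poch_succ_left (a : ℝ) (n : ℕ) : poch a (n + 1) = a * poch (a + 1) n := by
  simp [poch, ascPochhammer_succ_left, Polynomial.eval_comp]

theorem poch_pos {a : ℝ} (ha : 0 < a) (n : ℕ) : 0 < poch a n := ascPochhammer_pos n a ha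

theorem poch_neg_of_lt {i n : ℕ} (h : i < n) : poch (-(i : ℝ)) n = 0 :=
  ascPochhammer_eval_neg_coe_nat_of_lt h

theorem poch_neg_self (n : ℕ) : poch (-(n : ℝ)) n = (-1) ^ n * n.factorial := by
  induction n with
  | zero => simp [poch_zero]
  | succ n ih =>
    have e : -((n + 1 : ℕ) : ℝ) + 1 = -(n : ℝ) := by push_cast; ring
    rw [poch_succ_left, e, ih, Nat.factorial_succ]
    push_cast
    ring

theorem poch_one (n : ℕ) : poch 1 n = n.factorial := by
  simp [poch, ascPochhammer_eval_one]

open Polynomial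

/-- The coefficient of `(x - 1) ^ k` in `P_n^{(γ,α)}(2x - 1)`. -/
def jacobiExpCoeff (α γ : ℝ) (n k : ℕ) : ℝ :=
  poch (n + γ + α + 1) k * poch (γ + k + 1) (n - k) / ((k.factorial : ℝ) * ((n - k).factorial : ℝ))

/-- The polynomial `u ↦ P_n^{(γ,α)}(2u + 1)`. -/
def jacobiPolyAt (α γ : ℝ) (n : ℕ) : ℝ[X] :=
  ∑ k ∈ Finset.range (n + 1), C (jacobiExpCoeff α γ n k) * X ^ k

/-- The polynomial `x ↦ P_n^{(γ,α)}(2x - 1)`. -/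
def jacobiPoly (α γ : ℝ) (n : ℕ) : ℝ[X] := (jacobiPolyAt α γ n).comp (X - 1)

theorem coeff_jacobiPolyAt (α γ : ℝ) (n k : ℕ) :
    (jacobiPolyAt α γ n).coeff k = if k ≤ n then jacobiExpCoeff α γ n k else 0 := by
  simp [jacobiPolyAt, Polynomial.coeff_X_pow]

/-- The Rodrigues recursion in the variable `u = x - 1`, where `x (1 - x) = -(u + u²)`: up to sign,
the right side is the derivative of `P_n^{(γ+1,α+1)} w_{α+1,γ+1}` divided by `w_{α,γ}`. In powers of
`u` it is a coefficientwise identity. -/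
theorem jacobiPolyAt_succ (α γ : ℝ) (n : ℕ) :
    C ((n : ℝ) + 1) * jacobiPolyAt α γ (n + 1) =
      C (α + γ + 2) * (jacobiPolyAt (α + 1) (γ + 1) n * X) +
      C (γ + 1) * jacobiPolyAt (α + 1) (γ + 1) n +
      ((jacobiPolyAt (α + 1) (γ + 1) n).derivative * X +
        (jacobiPolyAt (α + 1) (γ + 1) n).derivative * X * X) := by
  have ez : ∀ n : ℕ, (n : ℝ) + (γ + 1) + (α + 1) + 1 = ((n + 1 : ℕ) + γ + α + 1) + 1 := by
    intro n; push_cast; ring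
  ext k
  rcases k with _ | k
  · simp only [coeff_C_mul, coeff_add, coeff_mul_X_zero, coeff_jacobiPolyAt, jacobiExpCoeff]
    simp only [zero_le, if_true, poch_zero, Nat.factorial_zero, Nat.sub_zero, Nat.factorial_succ,
      poch_succ_left _ n]
    push_cast
    have : (n.factorial : ℝ) ≠ 0 := by positivity
    have : (n : ℝ) + 1 ≠ 0 := by positivity
    field_simp
    ring_nf
  · have hX : ∀ q : ℝ[X], (q.derivative * X * X).coeff (k + 1) = k * q.coeff k := by
      intro q
      rw [coeff_mul_X]
      rcases k with _ | k
      · simp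
      · rw [coeff_mul_X, coeff_derivative]; push_cast; ring
    simp only [coeff_C_mul, coeff_add, hX, coeff_mul_X, coeff_derivative, coeff_jacobiPolyAt,
      jacobiExpCoeff, ez]
    rcases lt_trichotomy k n with h | h | h
    · obtain ⟨m, rfl⟩ : ∃ m, n = k + 1 + m := ⟨n - (k + 1), by omega⟩
      rw [if_pos (by omega), if_pos (by omega), if_pos (by omega)]
      have e1 : k + 1 + m + 1 - (k + 1) = m + 1 := by omega
      have e2 : k + 1 + m - k = m + 1 := by omega
      have e3 : k + 1 + m - (k + 1) = m := by omega
      rw [e1, e2, e3]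
      generalize hz : ((k + 1 + m + 1 : ℕ) : ℝ) + γ + α + 1 = z
      have e4 : γ + 1 + k + 1 = γ + k + 2 := by ring
      have e5 : γ + (k + 1 : ℕ) + 1 = γ + k + 2 := by push_cast; ring
      have e6 : γ + 1 + (k + 1 : ℕ) + 1 = γ + k + 2 + 1 := by push_cast; ring
      rw [e4, e5, e6, poch_succ_left z, poch_succ_left (γ + k + 2), poch_succ_right (z + 1)]
      -- Eliminating `α` leaves two common Pochhammer blocks, after which the identity is purely
      -- rational.
      have hα : α = z - ((k + 1 + m + 1 : ℕ) : ℝ) - γ - 1 := by rw [← hz]; ring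
      rw [hα]
      generalize poch (z + 1) k = A
      generalize poch (γ + k + 2 + 1) m = B
      rw [Nat.factorial_succ, Nat.factorial_succ]
      push_cast
      have : (k.factorial : ℝ) ≠ 0 := by positivity
      have : (m.factorial : ℝ) ≠ 0 := by positivity
      have : (k : ℝ) + 1 ≠ 0 := by positivity
      have : (m : ℝ) + 1 ≠ 0 := by positivity
      field_simp
      ring
    · subst h
      rw [if_pos le_rfl, if_pos le_rfl, if_neg (by omega)]
      simp only [Nat.sub_self, poch_zero, Nat.factorial_zero]
      rw [poch_succ_left, Nat.factorial_succ]
      push_cast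
      have : (k.factorial : ℝ) ≠ 0 := by positivity
      have : (k : ℝ) + 1 ≠ 0 := by positivity
      field_simp
      ring
    · rw [if_neg (by omega), if_neg (by omega), if_neg (by omega)]
      simp

theorem eval_jacobiPoly (α γ : ℝ) (n : ℕ) (x : ℝ) :
    (jacobiPoly α γ n).eval x = shiftedJacobi α γ n x := by
  simp only [jacobiPoly, jacobiPolyAt, shiftedJacobi, jacobiP, eval_comp, eval_finsetSum,
    jacobiExpCoeff]
  refine Finset.sum_congr rfl fun k _ => ?_
  simp
  left
  congr 1
  ring

theorem continuous_shiftedJacobi (α γ : ℝ) (n : ℕ) : Continuous (shiftedJacobi α γ n) := by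
  simpa only [eval_jacobiPoly] using (jacobiPoly α γ n).continuous

theorem shiftedJacobi_succ (α γ : ℝ) (n : ℕ) (x : ℝ) :
    ((n : ℝ) + 1) * shiftedJacobi α γ (n + 1) x =
      -((jacobiPoly (α + 1) (γ + 1) n).derivative.eval x * (x * (1 - x))) -
        shiftedJacobi (α + 1) (γ + 1) n x * ((α + 1) * (1 - x) - (γ + 1) * x) := by
  have h := congrArg (fun q => q.eval (x - 1)) (jacobiPolyAt_succ α γ n)
  simp only [eval_mul, eval_add, eval_C, eval_X] at h
  simp only [← eval_jacobiPoly, jacobiPoly, derivative_comp, eval_comp, eval_sub, eval_X,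
    eval_one, derivative_sub, derivative_X, derivative_one, sub_zero, one_mul]
  rw [h]
  ring

theorem natDegree_jacobiPolyAt_le (α γ : ℝ) (n : ℕ) : (jacobiPolyAt α γ n).natDegree ≤ n := by
  rw [natDegree_le_iff_coeff_eq_zero]
  intro k hk
  rw [coeff_jacobiPolyAt, if_neg (by omega)]

theorem jacobiPoly_eq_taylor (α γ : ℝ) (n : ℕ) :
    jacobiPoly α γ n = taylor (-1) (jacobiPolyAt α γ n) := by
  simp [jacobiPoly, taylor_apply, sub_eq_add_neg]

theorem natDegree_jacobiPoly_le (α γ : ℝ) (n : ℕ) : (jacobiPoly α γ n).natDegree ≤ n := by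
  rw [jacobiPoly_eq_taylor, natDegree_taylor]
  exact natDegree_jacobiPolyAt_le α γ n

theorem coeff_taylor_of_natDegree_le {q : ℝ[X]} {n : ℕ} (h : q.natDegree ≤ n) (r : ℝ) :
    (taylor r q).coeff n = q.coeff n := by
  rcases h.eq_or_lt with h | h
  · rw [← h, coeff_taylor_natDegree, leadingCoeff]
  · rw [coeff_eq_zero_of_natDegree_lt h, coeff_eq_zero_of_natDegree_lt (by rwa [natDegree_taylor])]

/-- The leading coefficient of `P_n^{(γ,α)}(2x - 1)`. -/
def jacobiLead (α γ : ℝ) (n : ℕ) : ℝ := poch (n + γ + α + 1) n / n.factorial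

theorem coeff_jacobiPoly (α γ : ℝ) (n : ℕ) : (jacobiPoly α γ n).coeff n = jacobiLead α γ n := by
  rw [jacobiPoly_eq_taylor, coeff_taylor_of_natDegree_le (natDegree_jacobiPolyAt_le α γ n),
    coeff_jacobiPolyAt, if_pos le_rfl, jacobiExpCoeff, jacobiLead]
  simp [poch_zero]

theorem jacobiLead_pos {α γ : ℝ} (hα : -1 < α) (hγ : -1 < γ) (n : ℕ) : 0 < jacobiLead α γ n := by
  unfold jacobiLead
  rcases n with _ | n
  -- Degree zero is separate: `γ + α + 1` may be negative, but the product is empty.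
  · simp [poch_zero]
  · have : 0 < poch ((n + 1 : ℕ) + γ + α + 1) (n + 1) := by
      apply poch_pos
      push_cast
      linarith [(n.cast_nonneg : (0 : ℝ) ≤ n)]
    positivity

/-- The value is independent of `α`; hence the Jacobi polynomials of the two edges agree at the
corner. -/
theorem shiftedJacobi_one (α γ : ℝ) (n : ℕ) :
    shiftedJacobi α γ n 1 = poch (γ + 1) n / n.factorial := by
  rw [← eval_jacobiPoly, jacobiPoly, eval_comp, eval_sub, eval_X, eval_one, sub_self,
    ← coeff_zero_eq_eval_zero, coeff_jacobiPolyAt]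
  simp [jacobiExpCoeff, poch_zero]

/-! ### Orthogonality relations and integrals against polynomials. -/

/-- The integral of a Jacobi polynomial against a weight with a different exponent at `1`. -/
theorem integral_shiftedJacobi {α g : ℝ} (hα : -1 < α) (hg : -1 < g) (γ : ℝ) (n : ℕ) :
    ∫ x, shiftedJacobi α γ n x ∂jacobiMeasure α g =
      poch (γ - g) n / n.factorial * jacobiMass (α + n) g := by
  induction n generalizing α γ with
  | zero => simp [shiftedJacobi, jacobiP, poch_zero, jacobiMass]
  | succ n ih =>
    have hn : (n : ℝ) + 1 ≠ 0 := by positivity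
    have hc := continuous_shiftedJacobi (α + 1) (γ + 1) n
    have hc' := continuous_shiftedJacobi α γ (n + 1)
    have hd : Continuous fun x => (jacobiPoly (α + 1) (γ + 1) n).derivative.eval x :=
      Polynomial.continuous _
    -- The Rodrigues recursion carries the exponent `γ` and the integration by parts carries `g`;
    -- their sum leaves only `(γ - g) x P_n^{(γ+1,α+1)}`, and the factor `x` raises `α` by one.
    have e : ((n : ℝ) + 1) * ∫ x, shiftedJacobi α γ (n + 1) x ∂jacobiMeasure α g =
        (γ - g) * ∫ x, shiftedJacobi (α + 1) (γ + 1) n x ∂jacobiMeasure (α + 1) g := by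
      have e1 : ∫ x, shiftedJacobi (α + 1) (γ + 1) n x ∂jacobiMeasure (α + 1) g =
          ∫ x, x * shiftedJacobi (α + 1) (γ + 1) n x ∂jacobiMeasure α g := by
        simpa using integral_jacobiMeasure_add α g 1 0 (shiftedJacobi (α + 1) (γ + 1) n)
      rw [e1, ← integral_const_mul, ← integral_const_mul, ← sub_eq_zero, ← integral_sub
        (integrable_jacobiMeasure_of_continuous hα hg
          (f := fun x => ((n : ℝ) + 1) * shiftedJacobi α γ (n + 1) x) (by fun_prop))
        (integrable_jacobiMeasure_of_continuous hα hg (by fun_prop)), ← neg_eq_zero,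
        ← integral_neg]
      rw [← integral_jacobiMeasure_deriv hα hg (jacobiPoly (α + 1) (γ + 1) n)]
      refine integral_congr_ae (Eventually.of_forall fun x => ?_)
      simp only [shiftedJacobi_succ, eval_jacobiPoly]
      ring
    rw [ih (by linarith)] at e
    have e2 : α + 1 + (n : ℝ) = α + (n + 1 : ℕ) := by push_cast; ring
    have e3 : γ + 1 - g = γ - g + 1 := by ring
    rw [e2, e3] at e
    rw [poch_succ_left, Nat.factorial_succ]
    have : (n.factorial : ℝ) ≠ 0 := by positivity
    push_cast at e ⊢
    field_simp at e ⊢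
    linarith

/-- Testing a Jacobi polynomial against polynomials of at most the same degree. -/
theorem integral_shiftedJacobi_mul {α γ : ℝ} (hα : -1 < α) (hγ : -1 < γ) {n : ℕ} {q : ℝ[X]}
    (hq : q.natDegree ≤ n) :
    ∫ x, shiftedJacobi α γ n x * q.eval x ∂jacobiMeasure α γ =
      q.coeff n * jacobiMass (α + n) (γ + n) := by
  have hp := continuous_shiftedJacobi α γ n
  -- Powers of `1 - x` are absorbed by the weight as `g = γ + i`, producing the factor `(-i)_n`,
  -- which vanishes for `i < n`; only the top coefficient survives.
  have he : ∀ x, q.eval x = ∑ i ∈ Finset.range (n + 1), (taylor 1 q).coeff i * (x - 1) ^ i := by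
    intro x
    have h := taylor_eval 1 q (x - 1)
    rw [sub_add_cancel] at h
    rw [← h, eval_eq_sum_range' (n := n + 1) (by rw [natDegree_taylor]; omega)]
  have hm : ∀ i : ℕ, ∫ x, shiftedJacobi α γ n x * (x - 1) ^ i ∂jacobiMeasure α γ =
      (-1) ^ i * (poch (-(i : ℝ)) n / n.factorial * jacobiMass (α + n) (γ + i)) := by
    intro i
    have h := integral_shiftedJacobi hα (g := γ + i)
      (by linarith [(i.cast_nonneg : (0 : ℝ) ≤ i)]) γ n
    rw [sub_add_cancel_left] at h
    have h' := integral_jacobiMeasure_add α γ 0 i (shiftedJacobi α γ n)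
    simp only [Nat.cast_zero, add_zero, pow_zero, one_mul] at h'
    rw [← h, h', ← integral_const_mul]
    refine integral_congr_ae (Eventually.of_forall fun x => ?_)
    simp only
    rw [← neg_sub 1 x, neg_pow]
    ring
  simp_rw [he, Finset.mul_sum]
  rw [integral_finsetSum _ fun i _ => integrable_jacobiMeasure_of_continuous hα hγ (by fun_prop)]
  have hs : ∀ i, ∫ x, shiftedJacobi α γ n x * ((taylor 1 q).coeff i * (x - 1) ^ i)
      ∂jacobiMeasure α γ = (taylor 1 q).coeff i *
        ((-1) ^ i * (poch (-(i : ℝ)) n / n.factorial * jacobiMass (α + n) (γ + i))) := by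
    intro i
    rw [← hm, ← integral_const_mul]
    refine integral_congr_ae (Eventually.of_forall fun x => ?_)
    simp only
    ring
  simp_rw [hs]
  rw [Finset.sum_range_succ, Finset.sum_eq_zero, coeff_taylor_of_natDegree_le hq, poch_neg_self]
  · have : (n.factorial : ℝ) ≠ 0 := by positivity
    have h1 : ((-1 : ℝ) ^ n) * (-1) ^ n = 1 := by rw [← mul_pow]; simp
    field_simp
    linear_combination q.coeff n * jacobiMass (α + n) (γ + n) * h1
  · intro i hi
    rw [poch_neg_of_lt (Finset.mem_range.1 hi)]
    simp

theorem integral_shiftedJacobi_sq {α γ : ℝ} (hα : -1 < α) (hγ : -1 < γ) (n : ℕ) :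
    ∫ x, shiftedJacobi α γ n x ^ 2 ∂jacobiMeasure α γ =
      jacobiLead α γ n * jacobiMass (α + n) (γ + n) := by
  rw [← coeff_jacobiPoly, ← integral_shiftedJacobi_mul hα hγ (natDegree_jacobiPoly_le α γ n)]
  simp only [eval_jacobiPoly, sq]

/-- The integral of `P_m^{(γ+2,α)}(2x-1) q(x)` against the weight `w_{α,γ+1}` only depends on
`q(1)`, for polynomials `q` of degree at most `m`. -/
theorem integral_shiftedJacobi_add_two_mul {α γ : ℝ} (hα : -1 < α) (hγ : -1 < γ) {m : ℕ} {q : ℝ[X]}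
    (hq : q.natDegree ≤ m) :
    ∫ x, (1 - x) * shiftedJacobi α (γ + 2) m x * q.eval x ∂jacobiMeasure α γ =
      q.eval 1 * jacobiMass (α + m) (γ + 1) := by
  -- Write `q = q(1) + (x - 1) r`. The second term turns the weight into `w_{α,γ+2}`, where `r` has
  -- too low a degree to contribute.
  obtain ⟨r, hr⟩ : (X - C 1 : ℝ[X]) ∣ q - C (q.eval 1) := by
    rw [dvd_iff_isRoot]; simp
  have hr' : r.coeff m = 0 := by
    by_cases h0 : r = 0
    · simp [h0]
    · refine coeff_eq_zero_of_natDegree_lt ?_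
      have h := congrArg natDegree hr
      rw [natDegree_mul (X_sub_C_ne_zero 1) h0, natDegree_X_sub_C] at h
      have h' : (q - C (q.eval 1)).natDegree ≤ m :=
        (natDegree_sub_le _ _).trans (by simp [hq])
      omega
  have hrd : r.natDegree ≤ m := by
    by_cases h0 : r = 0
    · simp [h0]
    · have h := congrArg natDegree hr
      rw [natDegree_mul (X_sub_C_ne_zero 1) h0, natDegree_X_sub_C] at h
      have h' : (q - C (q.eval 1)).natDegree ≤ m :=
        (natDegree_sub_le _ _).trans (by simp [hq])
      omega
  have h2 := integral_shiftedJacobi_mul hα (by linarith : -1 < γ + 2) hrd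
  rw [hr', zero_mul] at h2
  have e2 := integral_jacobiMeasure_add α γ 0 2 (fun x => shiftedJacobi α (γ + 2) m x * r.eval x)
  have e1 := integral_jacobiMeasure_add α γ 0 1 (shiftedJacobi α (γ + 2) m)
  simp only [Nat.cast_zero, add_zero, pow_zero, one_mul, Nat.cast_one, pow_one,
    Nat.cast_ofNat] at e1 e2
  have h1 := integral_shiftedJacobi hα (by linarith : -1 < γ + 1) (γ + 2) m
  -- The exponents differ by exactly one, so the factor `(1)_m / m!` is `1`.
  have e3 : γ + 2 - (γ + 1) = 1 := by ring
  rw [e3, poch_one, div_self (by positivity), one_mul, e1] at h1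
  rw [e2] at h2
  have hp := continuous_shiftedJacobi α (γ + 2) m
  have hrc : Continuous fun x => r.eval x := r.continuous
  rw [← h1, ← integral_const_mul, ← sub_zero (∫ x, q.eval 1 * _ ∂_), ← h2, ← integral_sub
    (integrable_jacobiMeasure_of_continuous hα hγ (by fun_prop))
    (integrable_jacobiMeasure_of_continuous hα hγ (by fun_prop))]
  refine integral_congr_ae (Eventually.of_forall fun x => ?_)
  have hx : q.eval x = q.eval 1 + (x - 1) * r.eval x := by
    have h := congrArg (fun p => p.eval x) hr
    simp only [eval_sub, eval_C, eval_mul, eval_X] at h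
    linarith
  simp only [hx]
  ring

/-- The factors in the definition of `Q_n` normalize this integral to a constant independent
of `α` and `n`. -/
theorem jacobiConst_mul_poch_mul_jacobiMass {α γ : ℝ} (hα : -1 < α) (hγ : -1 < γ) (m : ℕ) :
    jacobiConst α γ * (poch (γ + α + 2) (m + 1) / poch (α + 1) m) * jacobiMass (α + m) (γ + 1) =
      γ + 1 := by
  rw [jacobiConst_eq]
  have hb := jacobiMass_pos hα hγ
  induction m with
  | zero =>
    have h := jacobiMass_succ_right hα hγ
    simp only [poch_succ_left, poch_zero, Nat.cast_zero, add_zero]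
    field_simp
    linarith
  | succ m ih =>
    have hm : (0 : ℝ) ≤ m := m.cast_nonneg
    have h := jacobiMass_succ_left (α := α + m) (γ := γ + 1) (by linarith) (by linarith)
    have hp : poch (α + 1) m ≠ 0 := (poch_pos (by linarith) m).ne'
    have hz : α + 1 + m ≠ 0 := by linarith
    have hz' : γ + α + 2 + (m + 1) ≠ 0 := by linarith
    have e : α + ((m + 1 : ℕ) : ℝ) = α + m + 1 := by push_cast; ring
    rw [e, poch_succ_right _ (m + 1), poch_succ_right (α + 1) m]
    refine Eq.trans ?_ ih
    push_cast
    field_simp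
    linear_combination poch (γ + α + 2) (m + 1) * h

/-! ### Semi-inner products and best approximation, for functions rather than almost-everywhere
classes. -/

/-- `B` restricts to a positive semidefinite symmetric bilinear form on the subspace `W`. -/
structure IsSemiInner {V : Type*} [AddCommGroup V] [Module ℝ V] (W : Submodule ℝ V)
    (B : V → V → ℝ) : Prop where
  add_left : ∀ f ∈ W, ∀ g ∈ W, ∀ h ∈ W, B (f + g) h = B f h + B g h
  smul_left : ∀ (c : ℝ), ∀ f ∈ W, ∀ h ∈ W, B (c • f) h = c * B f h
  symm : ∀ f g, B f g = B g f
  nonneg : ∀ f ∈ W, 0 ≤ B f f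

namespace IsSemiInner

variable {V ι : Type*} [AddCommGroup V] [Module ℝ V] {W : Submodule ℝ V} {B : V → V → ℝ}

theorem zero_left (hB : IsSemiInner W B) {h : V} (hh : h ∈ W) : B 0 h = 0 := by
  simpa using hB.smul_left 0 0 W.zero_mem h hh

theorem add_right (hB : IsSemiInner W B) {f g h : V} (hf : f ∈ W) (hg : g ∈ W) (hh : h ∈ W) :
    B h (f + g) = B h f + B h g := by
  rw [hB.symm, hB.add_left f hf g hg h hh, hB.symm f, hB.symm g]

theorem smul_right (hB : IsSemiInner W B) (c : ℝ) {f h : V} (hf : f ∈ W) (hh : h ∈ W) :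
    B h (c • f) = c * B h f := by
  rw [hB.symm, hB.smul_left c f hf h hh, hB.symm f]

theorem sub_left (hB : IsSemiInner W B) {f g h : V} (hf : f ∈ W) (hg : g ∈ W) (hh : h ∈ W) :
    B (f - g) h = B f h - B g h := by
  rw [sub_eq_add_neg, hB.add_left f hf _ (W.neg_mem hg) h hh, ← neg_one_smul ℝ g,
    hB.smul_left _ g hg h hh]
  ring

theorem sub_right (hB : IsSemiInner W B) {f g h : V} (hf : f ∈ W) (hg : g ∈ W) (hh : h ∈ W) :
    B h (f - g) = B h f - B h g := by
  rw [hB.symm, hB.sub_left hf hg hh, hB.symm f, hB.symm g]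

theorem sum_left (hB : IsSemiInner W B) (s : Finset ι) {v : ι → V} (hv : ∀ i ∈ s, v i ∈ W)
    (c : ι → ℝ) {h : V} (hh : h ∈ W) :
    B (∑ i ∈ s, c i • v i) h = ∑ i ∈ s, c i * B (v i) h := by
  classical
  induction s using Finset.induction_on with
  | empty => simp [hB.zero_left hh]
  | insert a s ha ih =>
    have hs : ∀ i ∈ s, v i ∈ W := fun i hi => hv i (Finset.mem_insert_of_mem hi)
    have hva : v a ∈ W := hv a (Finset.mem_insert_self _ _)
    rw [Finset.sum_insert ha, Finset.sum_insert ha, hB.add_left _ (W.smul_mem _ hva) _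
      (W.sum_mem fun i hi => W.smul_mem _ (hs i hi)) h hh, hB.smul_left _ _ hva h hh, ih hs]

theorem eq_zero_of_mem_span (hB : IsSemiInner W B) {s : Set V} (hs : s ⊆ W) {e u : V} (he : e ∈ W)
    (h : ∀ v ∈ s, B e v = 0) (hu : u ∈ Submodule.span ℝ s) : B e u = 0 := by
  have hW : ∀ {x}, x ∈ Submodule.span ℝ s → x ∈ W := fun hx => Submodule.span_le.2 hs hx
  induction hu using Submodule.span_induction with
  | mem x hx => exact h x hx
  | zero => rw [hB.symm, hB.zero_left he]
  | add x y hx hy h1 h2 => rw [hB.add_right (hW hx) (hW hy) he, h1, h2, add_zero]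
  | smul c x hx h1 => rw [hB.smul_right c (hW hx) he, h1, mul_zero]

theorem sq_le (hB : IsSemiInner W B) {f g : V} (hf : f ∈ W) (hg : g ∈ W) (h0 : 0 < B g g) :
    B f g ^ 2 ≤ B f f * B g g := by
  have hs := W.smul_mem (B f g / B g g) hg
  have h := hB.nonneg _ (W.sub_mem hf hs)
  rw [hB.sub_left hf hs (W.sub_mem hf hs), hB.sub_right hf hs hf, hB.sub_right hf hs hs,
    hB.smul_left _ g hg f hf, hB.smul_left _ g hg _ hs, hB.smul_right _ hg hf,
    hB.smul_right _ hg hg, hB.symm g f] at h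
  have e : B f f - B f g / B g g * B f g - (B f g / B g g * B f g -
      B f g / B g g * (B f g / B g g * B g g)) = (B f f * B g g - B f g ^ 2) / B g g := by
    field_simp
    ring
  rw [e] at h
  rw [le_div_iff₀ h0] at h
  linarith

theorem add_self_le (hB : IsSemiInner W B) {f g : V} (hf : f ∈ W) (hg : g ∈ W) :
    B (f + g) (f + g) ≤ 2 * B f f + 2 * B g g := by
  have h := hB.nonneg _ (W.sub_mem hf hg)
  rw [hB.sub_left hf hg (W.sub_mem hf hg), hB.sub_right hf hg hf, hB.sub_right hf hg hg,
    hB.symm g f] at h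
  rw [hB.add_left f hf g hg _ (W.add_mem hf hg), hB.add_right hf hg hf, hB.add_right hf hg hg,
    hB.symm g f]
  linarith

/-- The error of an orthogonal expansion is orthogonal to the span of the system. -/
theorem sub_sum_orthogonal (hB : IsSemiInner W B) {s : Finset ι} {v : ι → V}
    (hv : ∀ i ∈ s, v i ∈ W) (ho : ∀ i ∈ s, ∀ j ∈ s, i ≠ j → B (v i) (v j) = 0)
    (hn : ∀ i ∈ s, B (v i) (v i) ≠ 0) {f u : V} (hf : f ∈ W)
    (hu : u ∈ Submodule.span ℝ (v '' s)) :
    B (f - ∑ i ∈ s, (B f (v i) / B (v i) (v i)) • v i) u = 0 := by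
  have hS : ∑ i ∈ s, (B f (v i) / B (v i) (v i)) • v i ∈ W :=
    W.sum_mem fun i hi => W.smul_mem _ (hv i hi)
  refine hB.eq_zero_of_mem_span (s := v '' s) ?_ (W.sub_mem hf hS) ?_ hu
  · rintro _ ⟨i, hi, rfl⟩
    exact hv i hi
  · rintro _ ⟨j, hj, rfl⟩
    rw [hB.sub_left hf hS (hv j hj), hB.sum_left s hv _ (hv j hj), Finset.sum_eq_single_of_mem j hj,
      div_mul_cancel₀ _ (hn j hj), sub_self]
    intro i hi hij
    rw [ho i hi j hj hij, mul_zero]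

/-- An orthogonal expansion is the best approximation from the span of the system. -/
theorem sub_sum_le (hB : IsSemiInner W B) {s : Finset ι} {v : ι → V}
    (hv : ∀ i ∈ s, v i ∈ W) (ho : ∀ i ∈ s, ∀ j ∈ s, i ≠ j → B (v i) (v j) = 0)
    (hn : ∀ i ∈ s, B (v i) (v i) ≠ 0) {f u : V} (hf : f ∈ W)
    (hu : u ∈ Submodule.span ℝ (v '' s)) :
    B (f - ∑ i ∈ s, (B f (v i) / B (v i) (v i)) • v i)
      (f - ∑ i ∈ s, (B f (v i) / B (v i) (v i)) • v i) ≤ B (f - u) (f - u) := by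
  have horth := hB.sub_sum_orthogonal hv ho hn hf (u := ∑ i ∈ s, (B f (v i) / B (v i) (v i)) • v i -
    u) (Submodule.sub_mem _ (Submodule.sum_mem _ fun i hi => Submodule.smul_mem _ _
      (Submodule.subset_span ⟨i, hi, rfl⟩)) hu)
  have hS : ∑ i ∈ s, (B f (v i) / B (v i) (v i)) • v i ∈ W :=
    W.sum_mem fun i hi => W.smul_mem _ (hv i hi)
  have huW : u ∈ W := by
    refine Submodule.span_le.2 ?_ hu
    rintro _ ⟨i, hi, rfl⟩
    exact hv i hi
  generalize ∑ i ∈ s, (B f (v i) / B (v i) (v i)) • v i = S at *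
  have e : f - u = (f - S) + (S - u) := by abel
  have h1 := W.sub_mem hf hS
  have h2 := W.sub_mem hS huW
  rw [e, hB.add_left _ h1 _ h2 _ (W.add_mem h1 h2), hB.add_right h1 h2 h1, hB.add_right h1 h2 h2,
    horth, hB.symm (S - u), horth]
  linarith [hB.nonneg _ h2]

end IsSemiInner

/-! ### Fourier–Jacobi expansions and completeness. -/

/-- The square integrable functions with respect to `μ`. -/
def squareIntegrable (μ : Measure ℝ) : Submodule ℝ (ℝ → ℝ) where
  carrier := {f | MemLp f 2 μ}
  add_mem' hf hg := MemLp.add hf hg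
  zero_mem' := MemLp.zero
  smul_mem' c _ hf := MemLp.const_smul hf c

theorem mem_squareIntegrable {μ : Measure ℝ} {f : ℝ → ℝ} :
    f ∈ squareIntegrable μ ↔ MemLp f 2 μ := Iff.rfl

/-- The inner product of `L²(w_{α,γ})`. -/
def jacobiInner (α γ : ℝ) (f g : ℝ → ℝ) : ℝ := ∫ x, f x * g x ∂jacobiMeasure α γ

theorem isSemiInner_jacobiInner (α γ : ℝ) :
    IsSemiInner (squareIntegrable (jacobiMeasure α γ)) (jacobiInner α γ) where
  add_left f hf g hg h hh := by
    have h1 : Integrable (fun x => f x * h x) (jacobiMeasure α γ) := MemLp.integrable_mul hf hh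
    have h2 : Integrable (fun x => g x * h x) (jacobiMeasure α γ) := MemLp.integrable_mul hg hh
    simp only [jacobiInner, Pi.add_apply, add_mul]
    exact integral_add h1 h2
  smul_left c f hf h hh := by
    simp only [jacobiInner, Pi.smul_apply, smul_eq_mul, mul_assoc]
    exact integral_const_mul _ _
  symm f g := by simp only [jacobiInner, mul_comm]
  nonneg f _ := integral_nonneg fun x => mul_self_nonneg _

theorem natDegree_le_of_coeff_eq_zero {q : ℝ[X]} {n : ℕ} (hq : q.natDegree ≤ n + 1)
    (h : q.coeff (n + 1) = 0) : q.natDegree ≤ n := by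
  rw [natDegree_le_iff_coeff_eq_zero] at hq ⊢
  intro k hk
  rcases eq_or_ne k (n + 1) with rfl | hk'
  · exact h
  · exact hq k (by omega)

theorem shiftedJacobi_zero (α γ x : ℝ) : shiftedJacobi α γ 0 x = 1 := by
  simp [shiftedJacobi, jacobiP, poch_zero]

theorem eval_mem_span_shiftedJacobi {α γ : ℝ} (hα : -1 < α) (hγ : -1 < γ) {n : ℕ} {q : ℝ[X]}
    (hq : q.natDegree ≤ n) : (fun x => q.eval x) ∈
      Submodule.span ℝ (shiftedJacobi α γ '' (Finset.range (n + 1) : Set ℕ)) := by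
  induction n generalizing q with
  | zero =>
    rw [eq_C_of_natDegree_le_zero hq]
    have e : (fun x => (C (q.coeff 0)).eval x) = q.coeff 0 • shiftedJacobi α γ 0 := by
      ext x
      simp [shiftedJacobi_zero]
    rw [e]
    exact Submodule.smul_mem _ _ (Submodule.subset_span ⟨0, by simp, rfl⟩)
  | succ n ih =>
    have hl := (jacobiLead_pos hα hγ (n + 1)).ne'
    set t := q.coeff (n + 1) / jacobiLead α γ (n + 1) with ht
    have h := ih (q := q - C t * jacobiPoly α γ (n + 1)) (natDegree_le_of_coeff_eq_zero
      ((natDegree_sub_le _ _).trans (max_le hq ((natDegree_C_mul_le _ _).trans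
        (natDegree_jacobiPoly_le _ _ _))))
      (by rw [coeff_sub, coeff_C_mul, coeff_jacobiPoly, ht, div_mul_cancel₀ _ hl, sub_self]))
    have e : (fun x => q.eval x) = (fun x => (q - C t * jacobiPoly α γ (n + 1)).eval x) +
        t • shiftedJacobi α γ (n + 1) := by
      ext x
      simp [eval_jacobiPoly]
    rw [e]
    refine Submodule.add_mem _ (Submodule.span_mono (Set.image_mono ?_) h)
      (Submodule.smul_mem _ _ (Submodule.subset_span ⟨n + 1, by simp, rfl⟩))
    intro k hk
    simp only [Finset.coe_range, Set.mem_Iio] at hk ⊢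
    omega

theorem memLp_eval {α γ : ℝ} (hα : -1 < α) (hγ : -1 < γ) (q : ℝ[X]) :
    (fun x => q.eval x) ∈ squareIntegrable (jacobiMeasure α γ) :=
  memLp_jacobiMeasure_of_continuous hα hγ q.continuous 2

theorem memLp_shiftedJacobi {α γ : ℝ} (hα : -1 < α) (hγ : -1 < γ) (a b : ℝ) (n : ℕ) :
    shiftedJacobi a b n ∈ squareIntegrable (jacobiMeasure α γ) :=
  memLp_jacobiMeasure_of_continuous hα hγ (continuous_shiftedJacobi a b n) 2

theorem jacobiInner_shiftedJacobi_eval {α γ : ℝ} (hα : -1 < α) (hγ : -1 < γ) {n : ℕ} {q : ℝ[X]}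
    (hq : q.natDegree ≤ n) : jacobiInner α γ (shiftedJacobi α γ n) (fun x => q.eval x) =
      q.coeff n * jacobiMass (α + n) (γ + n) :=
  integral_shiftedJacobi_mul hα hγ hq

theorem jacobiInner_shiftedJacobi_eval_of_lt {α γ : ℝ} (hα : -1 < α) (hγ : -1 < γ) {n : ℕ}
    {q : ℝ[X]} (hq : q.natDegree < n) :
    jacobiInner α γ (shiftedJacobi α γ n) (fun x => q.eval x) = 0 := by
  rw [jacobiInner_shiftedJacobi_eval hα hγ hq.le, coeff_eq_zero_of_natDegree_lt hq, zero_mul]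

theorem jacobiInner_shiftedJacobi_self {α γ : ℝ} (hα : -1 < α) (hγ : -1 < γ) (n : ℕ) :
    jacobiInner α γ (shiftedJacobi α γ n) (shiftedJacobi α γ n) =
      jacobiLead α γ n * jacobiMass (α + n) (γ + n) := by
  rw [← integral_shiftedJacobi_sq hα hγ n]
  simp only [jacobiInner, sq]

theorem jacobiInner_shiftedJacobi_self_pos {α γ : ℝ} (hα : -1 < α) (hγ : -1 < γ) (n : ℕ) :
    0 < jacobiInner α γ (shiftedJacobi α γ n) (shiftedJacobi α γ n) := by
  rw [jacobiInner_shiftedJacobi_self hα hγ n]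
  have hn : (0 : ℝ) ≤ n := n.cast_nonneg
  exact mul_pos (jacobiLead_pos hα hγ n) (jacobiMass_pos (by linarith) (by linarith))

theorem jacobiInner_shiftedJacobi_of_ne {α γ : ℝ} (hα : -1 < α) (hγ : -1 < γ) {m n : ℕ}
    (h : m ≠ n) : jacobiInner α γ (shiftedJacobi α γ m) (shiftedJacobi α γ n) = 0 := by
  have key : ∀ {m n : ℕ}, m < n →
      jacobiInner α γ (shiftedJacobi α γ n) (shiftedJacobi α γ m) = 0 := by
    intro m n h
    have := jacobiInner_shiftedJacobi_eval_of_lt hα hγ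
      ((natDegree_jacobiPoly_le α γ m).trans_lt h)
    simpa only [eval_jacobiPoly] using this
  rcases h.lt_or_gt with h | h
  · rw [(isSemiInner_jacobiInner α γ).symm, key h]
  · exact key h

theorem jacobiCoeff_eq (α γ : ℝ) (g : ℝ → ℝ) (n : ℕ) :
    jacobiCoeff α γ g n = jacobiInner α γ g (shiftedJacobi α γ n) /
      jacobiInner α γ (shiftedJacobi α γ n) (shiftedJacobi α γ n) := by
  simp only [jacobiCoeff, jacobiInner, sq]

theorem jacobiPartialSum_eq_sum (α γ : ℝ) (n : ℕ) (g : ℝ → ℝ) :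
    jacobiPartialSum α γ n g = ∑ k ∈ Finset.range (n + 1),
      (jacobiInner α γ g (shiftedJacobi α γ k) /
        jacobiInner α γ (shiftedJacobi α γ k) (shiftedJacobi α γ k)) • shiftedJacobi α γ k := by
  ext x
  simp [jacobiPartialSum, jacobiCoeff_eq]

/-- The partial sum of the Fourier–Jacobi series as a polynomial. -/
def jacobiPartialPoly (α γ : ℝ) (n : ℕ) (g : ℝ → ℝ) : ℝ[X] :=
  ∑ k ∈ Finset.range (n + 1), C (jacobiCoeff α γ g k) * jacobiPoly α γ k

theorem eval_jacobiPartialPoly (α γ : ℝ) (n : ℕ) (g : ℝ → ℝ) :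
    (fun x => (jacobiPartialPoly α γ n g).eval x) = jacobiPartialSum α γ n g := by
  ext x
  simp [jacobiPartialPoly, jacobiPartialSum, eval_finsetSum, eval_jacobiPoly]

theorem natDegree_jacobiPartialPoly_le (α γ : ℝ) (n : ℕ) (g : ℝ → ℝ) :
    (jacobiPartialPoly α γ n g).natDegree ≤ n := by
  refine natDegree_sum_le_of_forall_le _ _ fun k hk => ?_
  refine (natDegree_C_mul_le _ _).trans ((natDegree_jacobiPoly_le _ _ _).trans ?_)
  have := Finset.mem_range.1 hk
  omega

theorem jacobiError_sq (α γ : ℝ) (n : ℕ) (g : ℝ → ℝ) :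
    jacobiError α γ n g ^ 2 = jacobiInner α γ (g - jacobiPartialSum α γ n g)
      (g - jacobiPartialSum α γ n g) := by
  rw [jacobiError, jacobiL2Norm, Real.sq_sqrt (integral_nonneg fun x => sq_nonneg _)]
  simp only [jacobiInner, sq, abs_mul_abs_self, Pi.sub_apply]

theorem jacobiError_nonneg (α γ : ℝ) (n : ℕ) (g : ℝ → ℝ) : 0 ≤ jacobiError α γ n g :=
  Real.sqrt_nonneg _

theorem jacobiError_sq_le {α γ : ℝ} (hα : -1 < α) (hγ : -1 < γ) {n : ℕ}
    {g : ℝ → ℝ} (hg : MemLp g 2 (jacobiMeasure α γ)) {q : ℝ[X]} (hq : q.natDegree ≤ n) :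
    jacobiError α γ n g ^ 2 ≤
      jacobiInner α γ (g - fun x => q.eval x) (g - fun x => q.eval x) := by
  rw [jacobiError_sq, jacobiPartialSum_eq_sum]
  exact (isSemiInner_jacobiInner α γ).sub_sum_le
    (fun i _ => memLp_shiftedJacobi hα hγ α γ i)
    (fun i _ j _ h => jacobiInner_shiftedJacobi_of_ne hα hγ h)
    (fun i _ => (jacobiInner_shiftedJacobi_self_pos hα hγ i).ne') hg
    (eval_mem_span_shiftedJacobi hα hγ hq)

/-- Completeness of the Jacobi polynomials. -/
theorem tendsto_jacobiError {α γ : ℝ} (hα : -1 < α) (hγ : -1 < γ) {g : ℝ → ℝ}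
    (hg : MemLp g 2 (jacobiMeasure α γ)) :
    Tendsto (fun n => jacobiError α γ n g) atTop (𝓝 0) := by
  have := isFiniteMeasure_jacobiMeasure hα hγ
  have hB := isSemiInner_jacobiInner α γ
  have hM := jacobiMass_pos hα hγ
  rw [Metric.tendsto_atTop]
  intro ε hε
  -- Two approximations with squared error `δ`, by a continuous function and then by a polynomial,
  -- give at most `2δ + 2δ = ε² / 2`.
  set δ := ε ^ 2 / 8 with hδ
  have hδ0 : 0 < δ := by positivity
  obtain ⟨φ, hφ, hφ2⟩ := MemLp.exists_boundedContinuous_integral_rpow_sub_le (p := 2) two_pos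
    (by simpa using hg) hδ0
  set τ := Real.sqrt (δ / jacobiMass α γ) with hτ
  have hτ0 : 0 < τ := Real.sqrt_pos.2 (by positivity)
  obtain ⟨q, hq⟩ := exists_polynomial_near_of_continuousOn 0 1 φ φ.continuous.continuousOn τ hτ0
  refine ⟨q.natDegree, fun n hn => ?_⟩
  have hφW : (φ : ℝ → ℝ) ∈ squareIntegrable (jacobiMeasure α γ) := by
    simpa [mem_squareIntegrable] using hφ2
  have hqW := memLp_eval hα hγ q
  have h1 : jacobiInner α γ (g - φ) (g - φ) ≤ δ := by
    refine le_of_eq_of_le ?_ hφ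
    simp [jacobiInner, sq]
  have h2 : jacobiInner α γ (φ - fun x => q.eval x) (φ - fun x => q.eval x) ≤ δ := by
    have h : jacobiInner α γ (φ - fun x => q.eval x) (φ - fun x => q.eval x) ≤
        ∫ _x, τ ^ 2 * 1 ∂jacobiMeasure α γ := by
      refine integral_mono_ae (MemLp.integrable_mul (Submodule.sub_mem _ hφW hqW)
        (Submodule.sub_mem _ hφW hqW)) (integrable_const _) ?_
      filter_upwards [ae_mem_Ioo_jacobiMeasure α γ] with x hx
      have := hq x ⟨hx.1.le, hx.2.le⟩
      rw [abs_sub_comm] at this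
      simp only [Pi.sub_apply]
      rw [mul_one, ← sq, ← sq_abs (φ x - q.eval x)]
      gcongr
    rw [integral_const_mul, ← jacobiMass, hτ, Real.sq_sqrt (by positivity)] at h
    rwa [div_mul_cancel₀ _ hM.ne'] at h
  have h3 := hB.add_self_le (Submodule.sub_mem _ (mem_squareIntegrable.2 hg) hφW)
    (Submodule.sub_mem _ hφW hqW)
  rw [sub_add_sub_cancel] at h3
  have h4 := jacobiError_sq_le hα hγ hg hn
  rw [Real.dist_eq, sub_zero, abs_of_nonneg (jacobiError_nonneg _ _ _ _)]
  refine lt_of_pow_lt_pow_left₀ 2 hε.le ?_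
  have : 4 * δ < ε ^ 2 := by
    rw [hδ]
    have : 0 < ε ^ 2 := by positivity
    linarith
  linarith

/-! ### Approximation on one edge with a prescribed value at `1`. -/

/-- The partial sum of the Taylor-like expansion of `f` at `1` given by the
Fourier–Jacobi series (for the weight `w_{α,γ+2}`) of the difference quotient `g`. -/
def trialPoly (α γ a : ℝ) (g : ℝ → ℝ) (n : ℕ) : ℝ[X] :=
  C a + ∑ k ∈ Finset.range n, C (jacobiCoeff α (γ + 2) g k) * ((1 - X) * jacobiPoly α (γ + 2) k)

theorem eval_one_trialPoly (α γ a : ℝ) (g : ℝ → ℝ) (n : ℕ) : (trialPoly α γ a g n).eval 1 = a := by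
  simp [trialPoly, eval_finsetSum]

theorem natDegree_one_sub_X_mul_jacobiPoly_le (α γ : ℝ) (n : ℕ) :
    ((1 - X) * jacobiPoly α γ n).natDegree ≤ n + 1 := by
  refine natDegree_mul_le.trans ?_
  have h1 : (1 - X : ℝ[X]).natDegree ≤ 1 := (natDegree_sub_le _ _).trans (by simp)
  have := natDegree_jacobiPoly_le α γ n
  omega

theorem natDegree_trialPoly_le (α γ a : ℝ) (g : ℝ → ℝ) (n : ℕ) :
    (trialPoly α γ a g n).natDegree ≤ n := by
  refine (natDegree_add_le _ _).trans (max_le (by simp) ?_)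
  refine natDegree_sum_le_of_forall_le _ _ fun k hk => ?_
  refine (natDegree_C_mul_le _ _).trans ((natDegree_one_sub_X_mul_jacobiPoly_le _ _ _).trans ?_)
  exact Finset.mem_range.1 hk

theorem coeff_one_sub_X_mul_jacobiPoly (α γ : ℝ) (n : ℕ) :
    ((1 - X) * jacobiPoly α γ n).coeff (n + 1) = -jacobiLead α γ n := by
  rw [sub_mul, one_mul, coeff_sub, coeff_X_mul, coeff_jacobiPoly,
    coeff_eq_zero_of_natDegree_lt ((natDegree_jacobiPoly_le α γ n).trans_lt n.lt_succ_self),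
    zero_sub]

theorem trialPoly_succ (α γ a : ℝ) (g : ℝ → ℝ) (n : ℕ) :
    trialPoly α γ a g (n + 1) = trialPoly α γ a g n +
      C (jacobiCoeff α (γ + 2) g n) * ((1 - X) * jacobiPoly α (γ + 2) n) := by
  rw [trialPoly, trialPoly, Finset.sum_range_succ, add_assoc]

theorem coeff_trialPoly_succ (α γ a : ℝ) (g : ℝ → ℝ) (n : ℕ) :
    (trialPoly α γ a g (n + 1)).coeff (n + 1) =
      -(jacobiCoeff α (γ + 2) g n * jacobiLead α (γ + 2) n) := by
  rw [trialPoly_succ, coeff_add, coeff_C_mul, coeff_one_sub_X_mul_jacobiPoly,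
    coeff_eq_zero_of_natDegree_lt ((natDegree_trialPoly_le α γ a g n).trans_lt n.lt_succ_self)]
  ring

theorem jacobiInner_one_sub_mul (α γ : ℝ) (u v : ℝ → ℝ) :
    jacobiInner α γ (fun x => (1 - x) * u x) (fun x => (1 - x) * v x) =
      jacobiInner α (γ + 2) u v := by
  have h := integral_jacobiMeasure_add α γ 0 2 (fun x => u x * v x)
  simp only [Nat.cast_zero, add_zero, pow_zero, one_mul, Nat.cast_ofNat] at h
  rw [jacobiInner, jacobiInner, h]
  refine integral_congr_ae (Eventually.of_forall fun x => ?_)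
  simp only
  ring

theorem jacobiInner_congr_left {α γ : ℝ} {u v w : ℝ → ℝ} (h : ∀ x ∈ Set.Ioo (0 : ℝ) 1, u x = v x) :
    jacobiInner α γ u w = jacobiInner α γ v w := by
  refine integral_congr_ae ?_
  filter_upwards [ae_mem_Ioo_jacobiMeasure α γ] with x hx
  rw [h x hx]

theorem jacobiInner_self_congr {α γ : ℝ} {u v : ℝ → ℝ} (h : ∀ x ∈ Set.Ioo (0 : ℝ) 1, u x = v x) :
    jacobiInner α γ u u = jacobiInner α γ v v := by
  rw [jacobiInner_congr_left h, (isSemiInner_jacobiInner α γ).symm, jacobiInner_congr_left h]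

/-- On the open interval the difference is `(1 - x) (g - s_n g)`, and the factor `1 - x` is absorbed
by the weight. The index is `n + 1` because `trialPoly` at `n` uses only the terms `k < n`. -/
theorem jacobiInner_sub_trialPoly_succ (α γ a : ℝ) (f : ℝ → ℝ) (n : ℕ) :
    jacobiInner α γ
      (f - fun x => (trialPoly α γ a (fun x => (f x - a) / (1 - x)) (n + 1)).eval x)
      (f - fun x => (trialPoly α γ a (fun x => (f x - a) / (1 - x)) (n + 1)).eval x) =
      jacobiError α (γ + 2) n (fun x => (f x - a) / (1 - x)) ^ 2 := by
  rw [jacobiError_sq, ← jacobiInner_one_sub_mul]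
  refine jacobiInner_self_congr fun x hx => ?_
  have h1 : 1 - x ≠ 0 := (sub_pos.2 hx.2).ne'
  have h2 : (1 - x) * ((f x - a) / (1 - x)) = f x - a := by field_simp
  simp only [Pi.sub_apply, trialPoly, eval_add, eval_C, eval_finsetSum, eval_mul, eval_sub,
    eval_one, eval_X, eval_jacobiPoly, jacobiPartialSum, mul_sub, Finset.mul_sum, h2]
  rw [sub_sub]
  congr 2
  exact Finset.sum_congr rfl fun k _ => by ring

theorem jacobiLead_succ (α γ : ℝ) (n : ℕ) :
    ((n : ℝ) + 1) * jacobiLead α γ (n + 1) = (n + α + γ + 2) * jacobiLead α (γ + 2) n := by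
  have e1 : ((n + 1 : ℕ) : ℝ) + γ + α + 1 = n + α + γ + 2 := by push_cast; ring
  have e2 : (n : ℝ) + (γ + 2) + α + 1 = n + α + γ + 2 + 1 := by ring
  rw [jacobiLead, jacobiLead, e1, e2, poch_succ_left, Nat.factorial_succ]
  have : (n.factorial : ℝ) ≠ 0 := by positivity
  push_cast
  field_simp

/-- The ratio of the leading coefficients of the normalized Jacobi polynomials for `w_{α,γ}` and
`w_{α,γ+2}` is bounded. -/
def leadRatioBound (α γ : ℝ) : ℝ := (α + γ + 2) * (γ + 2) / (α + 1)

theorem leadRatioBound_pos {α γ : ℝ} (hα : -1 < α) (hγ : -1 < γ) : 0 < leadRatioBound α γ :=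
  div_pos (mul_pos (by linarith) (by linarith)) (by linarith)

theorem jacobiMass_mul_jacobiLead_le {α γ : ℝ} (hα : -1 < α) (hγ : -1 < γ) (n : ℕ) :
    jacobiMass (α + n) (γ + 2 + n) * jacobiLead α γ (n + 1) ≤ leadRatioBound α γ *
      (jacobiLead α (γ + 2) n * jacobiMass (α + (n + 1 : ℕ)) (γ + (n + 1 : ℕ))) := by
  have hn : (0 : ℝ) ≤ n := n.cast_nonneg
  have h1 := jacobiLead_succ α γ n
  have h2 := jacobiMass_succ_right_eq (α := α + n) (γ := γ + n + 1) (by linarith) (by linarith)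
  have e1 : γ + n + 1 + 1 = γ + 2 + n := by ring
  have e2 : α + ((n + 1 : ℕ) : ℝ) = α + n + 1 := by push_cast; ring
  have e3 : γ + ((n + 1 : ℕ) : ℝ) = γ + n + 1 := by push_cast; ring
  rw [e1] at h2
  rw [e2, e3]
  have hl := jacobiLead_pos hα (by linarith : -1 < γ + 2) n
  have hb := jacobiMass_pos (α := α + n + 1) (γ := γ + n + 1) (by linarith) (by linarith)
  have hn1 : 0 < (n : ℝ) + 1 := by linarith
  have ha1 : 0 < α + n + 1 := by linarith
  have hα1 : 0 < α + 1 := by linarith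
  rw [show jacobiLead α γ (n + 1) = (n + α + γ + 2) / (n + 1) * jacobiLead α (γ + 2) n by
      field_simp; linarith,
    show jacobiMass (α + n) (γ + 2 + n) =
      (γ + 2 + n) / (α + n + 1) * jacobiMass (α + n + 1) (γ + n + 1) by
      field_simp; linarith]
  -- Both ratios are largest at `n = 0`, since `γ + 1 > 0`; `leadRatioBound` is the product of these
  -- values.
  have k1 : (γ + 2 + n) / (n + 1) ≤ γ + 2 := by
    rw [div_le_iff₀ hn1]
    nlinarith
  have k2 : (n + α + γ + 2) / (α + n + 1) ≤ (α + γ + 2) / (α + 1) := by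
    rw [div_le_div_iff₀ ha1 hα1]
    nlinarith
  have k : (γ + 2 + n) / (n + 1) * ((n + α + γ + 2) / (α + n + 1)) ≤
      (γ + 2) * ((α + γ + 2) / (α + 1)) :=
    mul_le_mul k1 k2 (div_nonneg (by linarith) ha1.le) (by linarith)
  calc _ = (γ + 2 + n) / (n + 1) * ((n + α + γ + 2) / (α + n + 1)) *
        (jacobiLead α (γ + 2) n * jacobiMass (α + n + 1) (γ + n + 1)) := by field_simp
    _ ≤ (γ + 2) * ((α + γ + 2) / (α + 1)) *
        (jacobiLead α (γ + 2) n * jacobiMass (α + n + 1) (γ + n + 1)) := by gcongr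
    _ = _ := by rw [leadRatioBound]; ring

theorem memLp_sub_div_one_sub {α γ : ℝ} (hα : -1 < α) (hγ : -1 < γ) {f : ℝ → ℝ}
    (hf : MemLp f 2 (jacobiMeasure α γ)) (a : ℝ) :
    MemLp (fun x => (f x - a) / (1 - x)) 2 (jacobiMeasure α (γ + 2)) :=
  memLp_div_one_sub (hf.sub (memLp_jacobiMeasure_of_continuous hα hγ continuous_const 2))

/-- The error of the approximation of degree `n` that takes the prescribed value `a` at `1`. -/
theorem jacobiInner_sub_trialPoly_le {α γ : ℝ} (hα : -1 < α) (hγ : -1 < γ) {f : ℝ → ℝ}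
    (hf : MemLp f 2 (jacobiMeasure α γ)) (a : ℝ) (n : ℕ) :
    jacobiInner α γ
      (f - fun x => (trialPoly α γ a (fun x => (f x - a) / (1 - x)) n).eval x)
      (f - fun x => (trialPoly α γ a (fun x => (f x - a) / (1 - x)) n).eval x) ≤
      (2 + 4 * leadRatioBound α γ) * (jacobiError α γ n f ^ 2 +
        jacobiError α (γ + 2) n (fun x => (f x - a) / (1 - x)) ^ 2) := by
  have hB := isSemiInner_jacobiInner α γ
  have hK := leadRatioBound_pos hα hγ
  have hγ2 : -1 < γ + 2 := by linarith
  have hε := jacobiInner_sub_trialPoly_succ α γ a f n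
  set g : ℝ → ℝ := fun x => (f x - a) / (1 - x) with hg
  set ε := jacobiError α (γ + 2) n g
  set δ := jacobiError α γ n f
  set G := jacobiCoeff α (γ + 2) g n with hG
  set l := jacobiLead α (γ + 2) n with hl
  set b := jacobiMass (α + (n + 1 : ℕ)) (γ + (n + 1 : ℕ)) with hb
  have hn : (0 : ℝ) ≤ n := n.cast_nonneg
  have hl0 : 0 < l := jacobiLead_pos hα hγ2 n
  have hb0 : 0 < b := jacobiMass_pos (by push_cast; linarith) (by push_cast; linarith)
  have hfW : f ∈ squareIntegrable (jacobiMeasure α γ) := hf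
  set T := trialPoly α γ a g (n + 1) with hT
  set s := jacobiPartialPoly α γ n f with hs
  have hTf := Submodule.sub_mem _ hfW (memLp_eval hα hγ T)
  have hsf := Submodule.sub_mem _ hfW (memLp_eval hα hγ s)
  have hδ : jacobiInner α γ (f - fun x => s.eval x) (f - fun x => s.eval x) = δ ^ 2 := by
    rw [hs, eval_jacobiPartialPoly, ← jacobiError_sq]
  -- Both `T` and `s` are close to `f`, so `T - s` is small, while its coefficient of degree `n + 1`
  -- comes from `T` alone and exposes `G`.
  have hw2 : jacobiInner α γ (fun x => (T - s).eval x) (fun x => (T - s).eval x) ≤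
      2 * (δ ^ 2 + ε ^ 2) := by
    have h := hB.add_self_le hsf (Submodule.neg_mem _ hTf)
    have e1 : (f - fun x => s.eval x) + -(f - fun x => T.eval x) = fun x => (T - s).eval x := by
      ext x; simp
    have e2 : jacobiInner α γ (-(f - fun x => T.eval x)) (-(f - fun x => T.eval x)) = ε ^ 2 := by
      rw [← hε]
      simp only [jacobiInner, Pi.neg_apply, neg_mul_neg]
    rw [e1, e2, hδ] at h
    linarith
  have hcoef : (T - s).coeff (n + 1) = -(G * l) := by
    rw [coeff_sub, hT, coeff_trialPoly_succ, hs, coeff_eq_zero_of_natDegree_lt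
      ((natDegree_jacobiPartialPoly_le α γ n f).trans_lt n.lt_succ_self), sub_zero]
  have hdeg : (T - s).natDegree ≤ n + 1 :=
    (natDegree_sub_le _ _).trans (max_le (natDegree_trialPoly_le _ _ _ _ _)
      ((natDegree_jacobiPartialPoly_le _ _ _ _).trans n.le_succ))
  -- Pairing with the Jacobi polynomial of degree `n + 1` reads off that coefficient; Cauchy–Schwarz
  -- bounds it.
  have hcs := hB.sq_le (memLp_eval hα hγ (T - s)) (memLp_shiftedJacobi hα hγ α γ (n + 1))
    (jacobiInner_shiftedJacobi_self_pos hα hγ (n + 1))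
  rw [hB.symm, jacobiInner_shiftedJacobi_eval hα hγ hdeg, hcoef, jacobiInner_shiftedJacobi_self hα hγ,
    ← hb] at hcs
  have hL0 := jacobiLead_pos hα hγ (n + 1)
  have hcs' : G ^ 2 * l ^ 2 * b ≤ 2 * (δ ^ 2 + ε ^ 2) * jacobiLead α γ (n + 1) := by
    have h := hcs.trans (mul_le_mul_of_nonneg_right hw2 (mul_pos hL0 hb0).le)
    refine le_of_mul_le_mul_right ?_ hb0
    linarith
  have hratio := jacobiMass_mul_jacobiLead_le hα hγ n
  rw [← hl, ← hb] at hratio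
  have hm0 : 0 < jacobiMass (α + n) (γ + 2 + n) := jacobiMass_pos (by linarith) (by linarith)
  have hGh : G ^ 2 * (l * jacobiMass (α + n) (γ + 2 + n)) ≤
      leadRatioBound α γ * (2 * (δ ^ 2 + ε ^ 2)) := by
    have h1 := mul_le_mul_of_nonneg_right hcs' hm0.le
    have h2 := mul_le_mul_of_nonneg_left hratio (by positivity : 0 ≤ 2 * (δ ^ 2 + ε ^ 2))
    refine le_of_mul_le_mul_right ?_ (mul_pos hl0 hb0)
    linarith
  -- Removing the last term of `T` costs its squared norm, bounded by `hGh`; this gives `2ε² + 4K(δ²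
  -- + ε²)` with `K = leadRatioBound α γ`.
  have e : (f - fun x => (trialPoly α γ a g n).eval x) = (f - fun x => T.eval x) +
      G • fun x => (1 - x) * shiftedJacobi α (γ + 2) n x := by
    ext x
    simp [hT, trialPoly_succ, eval_jacobiPoly, ← hG]
    ring
  have hpW : (fun x => (1 - x) * shiftedJacobi α (γ + 2) n x) ∈
      squareIntegrable (jacobiMeasure α γ) := by
    have := continuous_shiftedJacobi α (γ + 2) n
    exact memLp_jacobiMeasure_of_continuous hα hγ (by fun_prop) 2
  have h := hB.add_self_le hTf (Submodule.smul_mem _ G hpW)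
  rw [hε, hB.smul_left _ _ hpW _ (Submodule.smul_mem _ G hpW), hB.smul_right _ hpW hpW,
    jacobiInner_one_sub_mul, jacobiInner_shiftedJacobi_self hα hγ2, ← hl] at h
  rw [e]
  nlinarith [sq_nonneg δ]

/-! ### The wedge as pairs of functions, and the polynomials `P_n`, `Q_n`, `R_n` on the edges. -/

/-- The restrictions of a function on the wedge to its two edges. -/
def edges (f : ℝ → ℝ → ℝ) : (ℝ → ℝ) × (ℝ → ℝ) := (fun x => f x 1, fun y => f 1 y)

/-- The inner product on the wedge, for pairs of functions on the edges. -/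
def edgeInner (α β γ σ : ℝ) (u v : (ℝ → ℝ) × (ℝ → ℝ)) : ℝ :=
  jacobiConst α γ * jacobiInner α γ u.1 v.1 + σ * jacobiConst β γ * jacobiInner β γ u.2 v.2

/-- The pairs of square integrable functions on the edges. -/
def edgeSpace (α β γ : ℝ) : Submodule ℝ ((ℝ → ℝ) × (ℝ → ℝ)) :=
  (squareIntegrable (jacobiMeasure α γ)).prod (squareIntegrable (jacobiMeasure β γ))

theorem inner_eq_edgeInner (α β γ σ : ℝ) (f g : ℝ → ℝ → ℝ) :
    inner α β γ σ f g = edgeInner α β γ σ (edges f) (edges g) := rfl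

theorem norm_eq_sqrt (α β γ σ : ℝ) (f : ℝ → ℝ → ℝ) :
    norm α β γ σ f = Real.sqrt (edgeInner α β γ σ (edges f) (edges f)) := by
  simp only [norm, edgeInner, jacobiInner, edges, sq, abs_mul_abs_self]

/-- The pair of functions given by two polynomials. -/
def evalPair (p q : ℝ[X]) : (ℝ → ℝ) × (ℝ → ℝ) := (fun x => p.eval x, fun y => q.eval y)

theorem isSemiInner_edgeInner {α β γ σ : ℝ} (hα : -1 < α) (hβ : -1 < β) (hγ : -1 < γ)
    (hσ : 0 < σ) : IsSemiInner (edgeSpace α β γ) (edgeInner α β γ σ) where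
  add_left f hf g hg h hh := by
    simp only [edgeInner, Prod.fst_add, Prod.snd_add]
    rw [(isSemiInner_jacobiInner α γ).add_left _ hf.1 _ hg.1 _ hh.1,
      (isSemiInner_jacobiInner β γ).add_left _ hf.2 _ hg.2 _ hh.2]
    ring
  smul_left c f hf h hh := by
    simp only [edgeInner, Prod.smul_fst, Prod.smul_snd]
    rw [(isSemiInner_jacobiInner α γ).smul_left _ _ hf.1 _ hh.1,
      (isSemiInner_jacobiInner β γ).smul_left _ _ hf.2 _ hh.2]
    ring
  symm f g := by
    simp only [edgeInner]
    rw [(isSemiInner_jacobiInner α γ).symm, (isSemiInner_jacobiInner β γ).symm]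
  nonneg f hf := add_nonneg
    (mul_nonneg (jacobiConst_pos hα hγ).le ((isSemiInner_jacobiInner α γ).nonneg _ hf.1))
    (mul_nonneg (mul_pos hσ (jacobiConst_pos hβ hγ)).le
      ((isSemiInner_jacobiInner β γ).nonneg _ hf.2))

theorem evalPair_mem {α β γ : ℝ} (hα : -1 < α) (hβ : -1 < β) (hγ : -1 < γ) (p q : ℝ[X]) :
    evalPair p q ∈ edgeSpace α β γ :=
  ⟨memLp_eval hα hγ p, memLp_eval hβ hγ q⟩

theorem edges_P (α β γ : ℝ) (n : ℕ) :
    edges (P α β γ n) = (shiftedJacobi α γ n, shiftedJacobi β γ n) := by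
  ext x <;> simp [edges, P, shiftedJacobi_one]

theorem edges_P_eq_evalPair (α β γ : ℝ) (n : ℕ) :
    edges (P α β γ n) = evalPair (jacobiPoly α γ n) (jacobiPoly β γ n) := by
  simp only [edges_P, evalPair, eval_jacobiPoly]

theorem edgeInner_P_self (α β γ σ : ℝ) (n : ℕ) :
    edgeInner α β γ σ (edges (P α β γ n)) (edges (P α β γ n)) =
      jacobiNormSq α γ n + σ * jacobiNormSq β γ n := by
  simp only [edges_P, edgeInner, jacobiNormSq, jacobiInner, sq]
  ring

/-- The normalizing factor `(γ+α+2)_{m+1} / (α+1)_m` in the definition of `Q_{m+1}`. -/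
def edgeFactor (α γ : ℝ) (m : ℕ) : ℝ := poch (γ + α + 2) (m + 1) / poch (α + 1) m

theorem edgeFactor_pos {α γ : ℝ} (hα : -1 < α) (hγ : -1 < γ) (m : ℕ) : 0 < edgeFactor α γ m :=
  div_pos (poch_pos (by linarith) _) (poch_pos (by linarith) _)

theorem edges_Q_succ (α β γ σ : ℝ) (m : ℕ) :
    edges (Q α β γ σ (m + 1)) = (edgeFactor α γ m • fun x => (1 - x) * shiftedJacobi α (γ + 2) m x,
      (-(σ⁻¹ * edgeFactor β γ m)) • fun y => (1 - y) * shiftedJacobi β (γ + 2) m y) := by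
  ext x <;> simp [edges, Q, edgeFactor]

theorem edges_Q_succ_eq_evalPair (α β γ σ : ℝ) (m : ℕ) :
    edges (Q α β γ σ (m + 1)) =
      evalPair (C (edgeFactor α γ m) * ((1 - X) * jacobiPoly α (γ + 2) m))
        (C (-(σ⁻¹ * edgeFactor β γ m)) * ((1 - X) * jacobiPoly β (γ + 2) m)) := by
  ext x <;> simp [edges_Q_succ, evalPair, eval_jacobiPoly]

/-- The coefficient of `P_n` in the definition of `R_n`. -/
def Rcoeff (α β γ σ : ℝ) (n : ℕ) : ℝ :=
  inner α β γ σ (P α β γ n) (Q α β γ σ n) / (jacobiNormSq α γ n + σ * jacobiNormSq β γ n)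

theorem edges_R (α β γ σ : ℝ) (n : ℕ) :
    edges (R α β γ σ n) =
      edges (Q α β γ σ n) - Rcoeff α β γ σ n • edges (P α β γ n) := by
  ext x <;> simp [edges, R, Rcoeff]

theorem edges_R_succ_eq_evalPair (α β γ σ : ℝ) (m : ℕ) :
    edges (R α β γ σ (m + 1)) =
      evalPair (C (edgeFactor α γ m) * ((1 - X) * jacobiPoly α (γ + 2) m) -
          C (Rcoeff α β γ σ (m + 1)) * jacobiPoly α γ (m + 1))
        (C (-(σ⁻¹ * edgeFactor β γ m)) * ((1 - X) * jacobiPoly β (γ + 2) m) -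
          C (Rcoeff α β γ σ (m + 1)) * jacobiPoly β γ (m + 1)) := by
  rw [edges_R, edges_Q_succ_eq_evalPair, edges_P_eq_evalPair]
  ext x <;> simp [evalPair]

theorem natDegree_edges_R_le (α γ s t : ℝ) (m : ℕ) :
    (C s * ((1 - X) * jacobiPoly α (γ + 2) m) - C t * jacobiPoly α γ (m + 1)).natDegree ≤ m + 1 :=
  (natDegree_sub_le _ _).trans (max_le
    ((natDegree_C_mul_le _ _).trans (natDegree_one_sub_X_mul_jacobiPoly_le _ _ _))
    ((natDegree_C_mul_le _ _).trans (natDegree_jacobiPoly_le _ _ _)))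

section

variable {α β γ σ : ℝ} (hα : -1 < α) (hβ : -1 < β) (hγ : -1 < γ) (hσ : 0 < σ)

include hα hβ hγ

theorem edges_P_mem (n : ℕ) : edges (P α β γ n) ∈ edgeSpace α β γ := by
  rw [edges_P_eq_evalPair]
  exact evalPair_mem hα hβ hγ _ _

theorem edges_Q_succ_mem (σ : ℝ) (m : ℕ) : edges (Q α β γ σ (m + 1)) ∈ edgeSpace α β γ := by
  rw [edges_Q_succ_eq_evalPair]
  exact evalPair_mem hα hβ hγ _ _

theorem edges_R_succ_mem (σ : ℝ) (m : ℕ) : edges (R α β γ σ (m + 1)) ∈ edgeSpace α β γ := by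
  rw [edges_R_succ_eq_evalPair]
  exact evalPair_mem hα hβ hγ _ _

theorem edgeInner_P_evalPair (σ : ℝ) {n : ℕ} {p q : ℝ[X]} (hp : p.natDegree < n)
    (hq : q.natDegree < n) : edgeInner α β γ σ (edges (P α β γ n)) (evalPair p q) = 0 := by
  rw [edges_P, edgeInner, evalPair]
  simp only
  rw [jacobiInner_shiftedJacobi_eval_of_lt hα hγ hp, jacobiInner_shiftedJacobi_eval_of_lt hβ hγ hq]
  ring

include hσ

theorem edgeInner_P_self_pos (n : ℕ) :
    0 < edgeInner α β γ σ (edges (P α β γ n)) (edges (P α β γ n)) := by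
  rw [edges_P]
  exact add_pos (mul_pos (jacobiConst_pos hα hγ) (jacobiInner_shiftedJacobi_self_pos hα hγ n))
    (mul_pos (mul_pos hσ (jacobiConst_pos hβ hγ)) (jacobiInner_shiftedJacobi_self_pos hβ hγ n))

/-- The factors in `Q` are chosen so that the two edges contribute `(γ + 1) p(1)` and `-(γ + 1)
q(1)`, with `σ⁻¹` cancelling `σ`; a common corner value makes the sum vanish. -/
theorem edgeInner_Q_evalPair {m : ℕ} {p q : ℝ[X]} (hp : p.natDegree ≤ m)
    (hq : q.natDegree ≤ m) (h1 : p.eval 1 = q.eval 1) :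
    edgeInner α β γ σ (edges (Q α β γ σ (m + 1))) (evalPair p q) = 0 := by
  have key : ∀ {α : ℝ}, -1 < α → ∀ {p : ℝ[X]}, p.natDegree ≤ m →
      jacobiConst α γ * (edgeFactor α γ m * jacobiInner α γ
        (fun x => (1 - x) * shiftedJacobi α (γ + 2) m x) (fun x => p.eval x)) =
        (γ + 1) * p.eval 1 := by
    intro α hα p hp
    rw [jacobiInner, integral_shiftedJacobi_add_two_mul hα hγ hp,
      edgeFactor]
    linear_combination p.eval 1 * jacobiConst_mul_poch_mul_jacobiMass hα hγ m
  have hW : ∀ {α : ℝ}, -1 < α → (fun x => (1 - x) * shiftedJacobi α (γ + 2) m x) ∈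
      squareIntegrable (jacobiMeasure α γ) := by
    intro α hα
    have := continuous_shiftedJacobi α (γ + 2) m
    exact memLp_jacobiMeasure_of_continuous hα hγ (by fun_prop) 2
  have k1 := key hα hp
  have k2 := key hβ hq
  rw [edges_Q_succ, edgeInner, evalPair]
  simp only
  rw [(isSemiInner_jacobiInner α γ).smul_left _ _ (hW hα) _ (memLp_eval hα hγ p),
    (isSemiInner_jacobiInner β γ).smul_left _ _ (hW hβ) _ (memLp_eval hβ hγ q)]
  have hs : σ * σ⁻¹ = 1 := mul_inv_cancel₀ hσ.ne'
  rw [← h1] at k2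
  linear_combination k1 - k2 - (jacobiConst β γ * (edgeFactor β γ m * jacobiInner β γ
        (fun x => (1 - x) * shiftedJacobi β (γ + 2) m x) (fun x => q.eval x))) * hs

theorem edgeInner_R_evalPair {m : ℕ} {p q : ℝ[X]} (hp : p.natDegree ≤ m)
    (hq : q.natDegree ≤ m) (h1 : p.eval 1 = q.eval 1) :
    edgeInner α β γ σ (edges (R α β γ σ (m + 1))) (evalPair p q) = 0 := by
  have hB := isSemiInner_edgeInner hα hβ hγ hσ
  have hP := edges_P_mem hα hβ hγ (m + 1)
  rw [edges_R, hB.sub_left (edges_Q_succ_mem hα hβ hγ σ m) (Submodule.smul_mem _ _ hP)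
    (evalPair_mem hα hβ hγ p q), hB.smul_left _ _ hP _ (evalPair_mem hα hβ hγ p q),
    edgeInner_Q_evalPair hα hβ hγ hσ hp hq h1,
    edgeInner_P_evalPair hα hβ hγ σ (Nat.lt_succ_of_le hp) (Nat.lt_succ_of_le hq)]
  ring

theorem edgeInner_P_R_succ (m : ℕ) :
    edgeInner α β γ σ (edges (P α β γ (m + 1))) (edges (R α β γ σ (m + 1))) = 0 := by
  have hB := isSemiInner_edgeInner hα hβ hγ hσ
  have hP := edges_P_mem hα hβ hγ (m + 1)
  rw [edges_R, hB.sub_right (edges_Q_succ_mem hα hβ hγ σ m) (Submodule.smul_mem _ _ hP) hP,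
    hB.smul_right _ hP hP, Rcoeff, ← edgeInner_P_self α β γ σ, inner_eq_edgeInner,
    div_mul_cancel₀ _ (edgeInner_P_self_pos hα hβ hγ hσ _).ne', sub_self]

end

/-! ### The system as an orthogonal basis of the pairs of polynomials that agree at the corner. -/

/-- The system `1 = P_0, P_1, P_2, …` and `R_1, R_2, …`, restricted to the edges. -/
def edgeSystem (α β γ σ : ℝ) : ℕ ⊕ ℕ → (ℝ → ℝ) × (ℝ → ℝ) :=
  Sum.elim (fun k => edges (P α β γ k)) (fun k => edges (R α β γ σ k))

/-- The indices of the elements of `edgeSystem` of degree at most `n`. -/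
def edgeIndex (n : ℕ) : Finset (ℕ ⊕ ℕ) := (Finset.range (n + 1)).disjSum (Finset.Icc 1 n)

theorem inl_mem_edgeIndex {k n : ℕ} : Sum.inl k ∈ edgeIndex n ↔ k ≤ n := by
  simp [edgeIndex]

theorem inr_mem_edgeIndex {k n : ℕ} : Sum.inr k ∈ edgeIndex n ↔ 1 ≤ k ∧ k ≤ n := by
  simp [edgeIndex]

theorem edgeIndex_mono {m n : ℕ} (h : m ≤ n) : edgeIndex m ⊆ edgeIndex n := by
  rintro (k | k) hk
  · rw [inl_mem_edgeIndex] at hk ⊢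
    omega
  · rw [inr_mem_edgeIndex] at hk ⊢
    omega

/-- Each element of the system is a pair of polynomials with a common value at `1`. -/
theorem exists_edgeSystem_eq_evalPair (α β γ σ : ℝ) {n : ℕ} {i : ℕ ⊕ ℕ} (hi : i ∈ edgeIndex n) :
    ∃ p q : ℝ[X], edgeSystem α β γ σ i = evalPair p q ∧ p.natDegree ≤ n ∧ q.natDegree ≤ n ∧
      p.eval 1 = q.eval 1 := by
  have hP1 : ∀ k, (jacobiPoly α γ k).eval 1 = (jacobiPoly β γ k).eval 1 := by
    intro k
    rw [eval_jacobiPoly, eval_jacobiPoly, shiftedJacobi_one, shiftedJacobi_one]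
  rcases i with k | k
  · rw [inl_mem_edgeIndex] at hi
    exact ⟨_, _, edges_P_eq_evalPair α β γ k, (natDegree_jacobiPoly_le _ _ _).trans hi,
      (natDegree_jacobiPoly_le _ _ _).trans hi, hP1 k⟩
  · obtain ⟨h1, h2⟩ := inr_mem_edgeIndex.1 hi
    obtain ⟨m, rfl⟩ : ∃ m, k = m + 1 := ⟨k - 1, by omega⟩
    refine ⟨_, _, edges_R_succ_eq_evalPair α β γ σ m, (natDegree_edges_R_le _ _ _ _ _).trans h2,
      (natDegree_edges_R_le _ _ _ _ _).trans h2, ?_⟩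
    simp [hP1]

/-- The constant `1` restricts to the same pair as `P_0`, so the separate constant term becomes the
index `Sum.inl 0`. -/
theorem edges_partialSum (α β γ σ : ℝ) (n : ℕ) (f : ℝ → ℝ → ℝ) :
    edges (partialSum α β γ σ n f) = ∑ i ∈ edgeIndex n,
      (edgeInner α β γ σ (edges f) (edgeSystem α β γ σ i) /
        edgeInner α β γ σ (edgeSystem α β γ σ i) (edgeSystem α β γ σ i)) •
        edgeSystem α β γ σ i := by
  have h1 : edges (P α β γ 0) = edges fun _ _ => 1 := by
    rw [edges_P]
    ext x <;> simp [edges, shiftedJacobi_zero]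
  rw [edgeIndex, Finset.sum_disjSum]
  induction n with
  | zero =>
    simp only [zero_add, Finset.range_one, Finset.sum_singleton, edgeSystem, Sum.elim_inl, h1]
    ext x <;> simp [edges, partialSum, coeff, inner_eq_edgeInner]
  | succ n ih =>
    have e : edges (partialSum α β γ σ (n + 1) f) = edges (partialSum α β γ σ n f) +
        (coeff α β γ σ f (P α β γ (n + 1)) • edges (P α β γ (n + 1)) +
          coeff α β γ σ f (R α β γ σ (n + 1)) • edges (R α β γ σ (n + 1))) := by
      ext x <;> simp [edges, partialSum, Finset.sum_Icc_succ_top, add_assoc]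
    rw [e, ih, Finset.sum_range_succ _ (n + 1), Finset.sum_Icc_succ_top (by omega)]
    simp only [edgeSystem, Sum.elim_inl, Sum.elim_inr, coeff, inner_eq_edgeInner]
    abel

section

variable {α β γ σ : ℝ} (hα : -1 < α) (hβ : -1 < β) (hγ : -1 < γ) (hσ : 0 < σ)

include hα hβ hγ

theorem edgeSystem_mem (σ : ℝ) {n : ℕ} : ∀ i ∈ edgeIndex n, edgeSystem α β γ σ i ∈
    edgeSpace α β γ := by
  rintro (k | k) hk
  · exact edges_P_mem hα hβ hγ k
  · obtain ⟨m, rfl⟩ : ∃ m, k = m + 1 := ⟨k - 1, by have := (inr_mem_edgeIndex.1 hk).1; omega⟩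
    exact edges_R_succ_mem hα hβ hγ σ m

include hσ

/-- If the norm vanished, Cauchy–Schwarz would make `R` orthogonal to the top Jacobi polynomial on
each edge separately, so both top coefficients would be zero. The two parts of `Q` have top
coefficients of opposite signs, whereas those of `P` are both positive, so no single multiple of `P`
cancels both. -/
theorem edgeInner_R_succ_self_ne_zero (m : ℕ) :
    edgeInner α β γ σ (edges (R α β γ σ (m + 1))) (edges (R α β γ σ (m + 1))) ≠ 0 := by
  intro h0
  have hB := isSemiInner_edgeInner hα hβ hγ hσ
  have hR := edges_R_succ_mem hα hβ hγ σ m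
  have hn : (0 : ℝ) ≤ (m + 1 : ℕ) := Nat.cast_nonneg _
  have hz : ∀ u ∈ edgeSpace α β γ, 0 < edgeInner α β γ σ u u →
      edgeInner α β γ σ u (edges (R α β γ σ (m + 1))) = 0 := by
    intro u hu hpos
    have h := hB.sq_le hR hu hpos
    rw [h0, zero_mul, hB.symm] at h
    exact pow_eq_zero_iff two_ne_zero |>.1 (le_antisymm h (sq_nonneg _))
  have hz0 : ∀ (α : ℝ) (u : ℝ → ℝ), jacobiInner α γ 0 u = 0 := fun α u => by simp [jacobiInner]
  have d1 := natDegree_edges_R_le α γ (edgeFactor α γ m) (Rcoeff α β γ σ (m + 1)) m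
  have d2 := natDegree_edges_R_le β γ (-(σ⁻¹ * edgeFactor β γ m)) (Rcoeff α β γ σ (m + 1)) m
  have hα' := jacobiMass_pos (α := α + (m + 1 : ℕ)) (γ := γ + (m + 1 : ℕ)) (by linarith)
    (by linarith)
  have hβ' := jacobiMass_pos (α := β + (m + 1 : ℕ)) (γ := γ + (m + 1 : ℕ)) (by linarith)
    (by linarith)
  have k1 := hz (shiftedJacobi α γ (m + 1), 0) ⟨memLp_shiftedJacobi hα hγ _ _ _,
    Submodule.zero_mem _⟩ (by
      simp only [edgeInner, hz0, mul_zero, add_zero]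
      exact mul_pos (jacobiConst_pos hα hγ) (jacobiInner_shiftedJacobi_self_pos hα hγ _))
  have k2 := hz (0, shiftedJacobi β γ (m + 1)) ⟨Submodule.zero_mem _,
    memLp_shiftedJacobi hβ hγ _ _ _⟩ (by
      simp only [edgeInner, hz0, mul_zero, zero_add]
      exact mul_pos (mul_pos hσ (jacobiConst_pos hβ hγ))
        (jacobiInner_shiftedJacobi_self_pos hβ hγ _))
  rw [edges_R_succ_eq_evalPair] at k1 k2
  simp only [edgeInner, evalPair, hz0, mul_zero, add_zero, zero_add] at k1 k2
  rw [jacobiInner_shiftedJacobi_eval hα hγ d1, coeff_sub, coeff_C_mul, coeff_C_mul,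
    coeff_one_sub_X_mul_jacobiPoly, coeff_jacobiPoly] at k1
  rw [jacobiInner_shiftedJacobi_eval hβ hγ d2, coeff_sub, coeff_C_mul, coeff_C_mul,
    coeff_one_sub_X_mul_jacobiPoly, coeff_jacobiPoly] at k2
  have c1 := (jacobiConst_pos hα hγ).ne'
  have c2 := (mul_pos hσ (jacobiConst_pos hβ hγ)).ne'
  simp only [mul_eq_zero, c1, false_or, hα'.ne', or_false] at k1
  rcases mul_eq_zero.1 k2 with k2 | k2
  · exact c2 k2
  · have k3 := (mul_eq_zero.1 k2).resolve_right hβ'.ne'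
    have hγ2 : -1 < γ + 2 := by linarith
    have l1 := jacobiLead_pos hα hγ (m + 1)
    have l2 := jacobiLead_pos hβ hγ (m + 1)
    have p1 := mul_pos (edgeFactor_pos hα hγ m) (jacobiLead_pos hα hγ2 m)
    have p2 := mul_pos (mul_pos (inv_pos.2 hσ) (edgeFactor_pos hβ hγ m))
      (jacobiLead_pos hβ hγ2 m)
    have t1 : Rcoeff α β γ σ (m + 1) < 0 := by
      by_contra h
      have := mul_nonneg (not_lt.1 h) l1.le
      linarith
    have := mul_neg_of_neg_of_pos t1 l2
    linarith

theorem edgeSystem_self_ne_zero {n : ℕ} : ∀ i ∈ edgeIndex n,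
    edgeInner α β γ σ (edgeSystem α β γ σ i) (edgeSystem α β γ σ i) ≠ 0 := by
  rintro (k | k) hk
  · exact (edgeInner_P_self_pos hα hβ hγ hσ k).ne'
  · obtain ⟨m, rfl⟩ : ∃ m, k = m + 1 := ⟨k - 1, by have := (inr_mem_edgeIndex.1 hk).1; omega⟩
    exact edgeInner_R_succ_self_ne_zero hα hβ hγ hσ m

theorem edgeSystem_orthogonal {n : ℕ} : ∀ i ∈ edgeIndex n, ∀ j ∈ edgeIndex n, i ≠ j →
    edgeInner α β γ σ (edgeSystem α β γ σ i) (edgeSystem α β γ σ j) = 0 := by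
  have hB := isSemiInner_edgeInner hα hβ hγ hσ
  have hP : ∀ {k l : ℕ}, k < l → ∀ j ∈ edgeIndex k,
      edgeInner α β γ σ (edgeSystem α β γ σ (Sum.inl l)) (edgeSystem α β γ σ j) = 0 := by
    intro k l hkl j hj
    obtain ⟨p, q, e, hp, hq, -⟩ := exists_edgeSystem_eq_evalPair α β γ σ hj
    rw [e]
    exact edgeInner_P_evalPair hα hβ hγ σ (by omega) (by omega)
  -- Unlike for `P`, orthogonality of `R` to lower degrees uses the common value at `1`.
  have hR : ∀ {k l : ℕ}, k < l → ∀ j ∈ edgeIndex k,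
      edgeInner α β γ σ (edgeSystem α β γ σ (Sum.inr l)) (edgeSystem α β γ σ j) = 0 := by
    intro k l hkl j hj
    obtain ⟨m, rfl⟩ : ∃ m, l = m + 1 := ⟨l - 1, by omega⟩
    obtain ⟨p, q, e, hp, hq, h1⟩ := exists_edgeSystem_eq_evalPair α β γ σ hj
    rw [e]
    exact edgeInner_R_evalPair hα hβ hγ hσ (by omega) (by omega) h1
  have hPR : ∀ k l : ℕ, 1 ≤ l →
      edgeInner α β γ σ (edgeSystem α β γ σ (Sum.inl k)) (edgeSystem α β γ σ (Sum.inr l)) = 0 := by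
    intro k l hl
    rcases lt_trichotomy k l with h | rfl | h
    · rw [hB.symm]
      exact hR h _ (inl_mem_edgeIndex.2 le_rfl)
    · obtain ⟨m, rfl⟩ : ∃ m, k = m + 1 := ⟨k - 1, by omega⟩
      exact edgeInner_P_R_succ hα hβ hγ hσ m
    · exact hP h _ (inr_mem_edgeIndex.2 ⟨hl, le_rfl⟩)
  rintro (k | k) hk (l | l) hl hkl
  · rcases lt_or_gt_of_ne (fun h => hkl (congrArg Sum.inl h) : k ≠ l) with h | h
    · rw [hB.symm]
      exact hP h _ (inl_mem_edgeIndex.2 le_rfl)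
    · exact hP h _ (inl_mem_edgeIndex.2 le_rfl)
  · exact hPR k l (inr_mem_edgeIndex.1 hl).1
  · rw [hB.symm]
    exact hPR l k (inr_mem_edgeIndex.1 hk).1
  · rcases lt_or_gt_of_ne (fun h => hkl (congrArg Sum.inr h) : k ≠ l) with h | h
    · rw [hB.symm]
      exact hR h _ (inr_mem_edgeIndex.2 ⟨(inr_mem_edgeIndex.1 hk).1, le_rfl⟩)
    · exact hR h _ (inr_mem_edgeIndex.2 ⟨(inr_mem_edgeIndex.1 hl).1, le_rfl⟩)

/-- The system spans the pairs of polynomials of degree at most `n` with a common value at `1`. -/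
theorem evalPair_mem_span {n : ℕ} {p q : ℝ[X]} (hp : p.natDegree ≤ n) (hq : q.natDegree ≤ n)
    (h1 : p.eval 1 = q.eval 1) :
    evalPair p q ∈ Submodule.span ℝ (edgeSystem α β γ σ '' (edgeIndex n : Set (ℕ ⊕ ℕ))) := by
  induction n generalizing p q with
  | zero =>
    rw [eq_C_of_natDegree_le_zero hp, eq_C_of_natDegree_le_zero hq] at h1 ⊢
    simp only [eval_C] at h1
    have e : evalPair (C (p.coeff 0)) (C (q.coeff 0)) =
        p.coeff 0 • edgeSystem α β γ σ (Sum.inl 0) := by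
      ext x <;> simp [evalPair, edgeSystem, edges_P, shiftedJacobi_zero, h1]
    rw [e]
    exact Submodule.smul_mem _ _ (Submodule.subset_span
      ⟨_, inl_mem_edgeIndex.2 le_rfl, rfl⟩)
  | succ m ih =>
    have hγ2 : -1 < γ + 2 := by linarith
    set l₁ := jacobiLead α γ (m + 1) with hl₁
    set l₂ := jacobiLead β γ (m + 1) with hl₂
    set k₁ := edgeFactor α γ m * jacobiLead α (γ + 2) m with hk₁
    set k₂ := σ⁻¹ * edgeFactor β γ m * jacobiLead β (γ + 2) m with hk₂
    -- The determinant of the `2 × 2` system matching both top coefficients with multiples of `P`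
    -- and `Q`; `x` and `y` below are its solution by Cramer's rule.
    have hd : 0 < l₁ * k₂ + k₁ * l₂ := add_pos
      (mul_pos (jacobiLead_pos hα hγ _) (mul_pos (mul_pos (inv_pos.2 hσ) (edgeFactor_pos hβ hγ m))
        (jacobiLead_pos hβ hγ2 m)))
      (mul_pos (mul_pos (edgeFactor_pos hα hγ m) (jacobiLead_pos hα hγ2 m))
        (jacobiLead_pos hβ hγ _))
    set a := p.coeff (m + 1) with ha
    set b := q.coeff (m + 1) with hb
    set x := (k₂ * a + k₁ * b) / (l₁ * k₂ + k₁ * l₂) with hx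
    set y := (l₁ * b - l₂ * a) / (l₁ * k₂ + k₁ * l₂) with hy
    have hd' := hd.ne'
    have hxa : x * l₁ - y * k₁ = a := by
      rw [hx, hy, div_mul_eq_mul_div, div_mul_eq_mul_div, ← sub_div, div_eq_iff hd']
      ring
    have hxb : x * l₂ + y * k₂ = b := by
      rw [hx, hy, div_mul_eq_mul_div, div_mul_eq_mul_div, ← add_div, div_eq_iff hd']
      ring
    set p' := p - C x * jacobiPoly α γ (m + 1) -
      C y * (C (edgeFactor α γ m) * ((1 - X) * jacobiPoly α (γ + 2) m)) with hp'
    set q' := q - C x * jacobiPoly β γ (m + 1) -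
      C y * (C (-(σ⁻¹ * edgeFactor β γ m)) * ((1 - X) * jacobiPoly β (γ + 2) m)) with hq'
    have deg : ∀ {r : ℝ[X]} (α s : ℝ), r.natDegree ≤ m + 1 →
        (r - C x * jacobiPoly α γ (m + 1) -
          C y * (C s * ((1 - X) * jacobiPoly α (γ + 2) m))).natDegree ≤ m + 1 := by
      intro r α s hr
      refine (natDegree_sub_le _ _).trans (max_le ((natDegree_sub_le _ _).trans (max_le hr
        ((natDegree_C_mul_le _ _).trans (natDegree_jacobiPoly_le _ _ _)))) ?_)
      exact (natDegree_C_mul_le _ _).trans ((natDegree_C_mul_le _ _).trans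
        (natDegree_one_sub_X_mul_jacobiPoly_le _ _ _))
    have hmem := ih (p := p') (q := q')
      (natDegree_le_of_coeff_eq_zero (deg α _ hp) (by
        simp only [hp', coeff_sub, coeff_C_mul, coeff_one_sub_X_mul_jacobiPoly, coeff_jacobiPoly]
        rw [← ha, ← hl₁, mul_neg, ← hk₁]
        linarith))
      (natDegree_le_of_coeff_eq_zero (deg β _ hq) (by
        simp only [hq', coeff_sub, coeff_C_mul, coeff_one_sub_X_mul_jacobiPoly, coeff_jacobiPoly]
        rw [← hb, ← hl₂, neg_mul_neg, ← hk₂]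
        linarith))
      (by simp [hp', hq', eval_jacobiPoly, shiftedJacobi_one, h1])
    -- Since `Q = R + Rcoeff • P`, passing from `Q` to `R` changes only the coefficient of `P`.
    have e : evalPair p q = evalPair p' q' + (x + y * Rcoeff α β γ σ (m + 1)) •
        edgeSystem α β γ σ (Sum.inl (m + 1)) + y • edgeSystem α β γ σ (Sum.inr (m + 1)) := by
      simp only [edgeSystem, Sum.elim_inl, Sum.elim_inr, edges_R_succ_eq_evalPair,
        edges_P_eq_evalPair]
      ext z <;> simp [evalPair, hp', hq'] <;> ring
    rw [e]
    refine Submodule.add_mem _ (Submodule.add_mem _ ?_ (Submodule.smul_mem _ _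
      (Submodule.subset_span ⟨_, inl_mem_edgeIndex.2 le_rfl, rfl⟩)))
      (Submodule.smul_mem _ _ (Submodule.subset_span
        ⟨_, inr_mem_edgeIndex.2 ⟨by omega, le_rfl⟩, rfl⟩))
    exact Submodule.span_mono (Set.image_mono (Finset.coe_subset.2 (edgeIndex_mono m.le_succ)))
      hmem

/-! ### Best approximation on the wedge and the final estimates. -/

/-- The partial sum is the best approximation by pairs of polynomials with a common value
at `1`. -/
theorem norm_sub_partialSum_sq_le {f : ℝ → ℝ → ℝ} (hf : MemL2 α β γ f) {n : ℕ} {p q : ℝ[X]}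
    (hp : p.natDegree ≤ n) (hq : q.natDegree ≤ n) (h1 : p.eval 1 = q.eval 1) :
    norm α β γ σ (fun x y => f x y - partialSum α β γ σ n f x y) ^ 2 ≤
      edgeInner α β γ σ (edges f - evalPair p q) (edges f - evalPair p q) := by
  have hB := isSemiInner_edgeInner hα hβ hγ hσ
  have hfW : edges f ∈ edgeSpace α β γ := hf
  have h := hB.sub_sum_le (edgeSystem_mem hα hβ hγ σ (n := n))
    (edgeSystem_orthogonal hα hβ hγ hσ) (edgeSystem_self_ne_zero hα hβ hγ hσ) hfW
    (evalPair_mem_span hα hβ hγ hσ hp hq h1)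
  rw [← edges_partialSum] at h
  rw [norm_eq_sqrt, Real.sq_sqrt]
  · exact h
  · refine hB.nonneg _ (Submodule.sub_mem _ hfW (x := edges f)
      (y := edges (partialSum α β γ σ n f)) ?_)
    rw [edges_partialSum]
    exact Submodule.sum_mem _ fun i hi => Submodule.smul_mem _ _ (edgeSystem_mem hα hβ hγ σ i hi)

theorem exists_norm_sub_partialSum_le :
    ∃ c : ℝ, 0 < c ∧ ∀ f : ℝ → ℝ → ℝ, MemL2 α β γ f → ∀ n : ℕ,
      norm α β γ σ (fun x y => f x y - partialSum α β γ σ n f x y) ≤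
        c * (jacobiError α γ n (f₁ f) + jacobiError β γ n (f₂ f)) +
        c * (jacobiError α (γ + 2) n (g₁ f) + jacobiError β (γ + 2) n (g₂ f)) := by
  have cα := jacobiConst_pos hα hγ
  have cβ := mul_pos hσ (jacobiConst_pos hβ hγ)
  have Kα : 0 < 2 + 4 * leadRatioBound α γ := by linarith [leadRatioBound_pos hα hγ]
  have Kβ : 0 < 2 + 4 * leadRatioBound β γ := by linarith [leadRatioBound_pos hβ hγ]
  set M := jacobiConst α γ * (2 + 4 * leadRatioBound α γ) +
    σ * jacobiConst β γ * (2 + 4 * leadRatioBound β γ) with hM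
  have hM1 : jacobiConst α γ * (2 + 4 * leadRatioBound α γ) ≤ M := by
    linarith [mul_pos cβ Kβ]
  have hM2 : σ * jacobiConst β γ * (2 + 4 * leadRatioBound β γ) ≤ M := by
    linarith [mul_pos cα Kα]
  have hM0 : 0 < M := (mul_pos cα Kα).trans_le hM1
  refine ⟨Real.sqrt M, Real.sqrt_pos.2 hM0, fun f hf n => ?_⟩
  -- The two trial polynomials both equal `f(1,1)` at `1`, so they form an admissible competitor.
  have h := norm_sub_partialSum_sq_le hα hβ hγ hσ hf
    (natDegree_trialPoly_le α γ (f 1 1) (g₁ f) n) (natDegree_trialPoly_le β γ (f 1 1) (g₂ f) n)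
    (by rw [eval_one_trialPoly, eval_one_trialPoly])
  have t1 := mul_le_mul_of_nonneg_left (jacobiInner_sub_trialPoly_le hα hγ hf.1 (f 1 1) n) cα.le
  have t2 := mul_le_mul_of_nonneg_left (jacobiInner_sub_trialPoly_le hβ hγ hf.2 (f 1 1) n) cβ.le
  have h2 := h.trans (add_le_add t1 t2)
  change _ ≤ jacobiConst α γ * ((2 + 4 * leadRatioBound α γ) *
      (jacobiError α γ n (f₁ f) ^ 2 + jacobiError α (γ + 2) n (g₁ f) ^ 2)) +
    σ * jacobiConst β γ * ((2 + 4 * leadRatioBound β γ) *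
      (jacobiError β γ n (f₂ f) ^ 2 + jacobiError β (γ + 2) n (g₂ f) ^ 2)) at h2
  have n1 := jacobiError_nonneg α γ n (f₁ f)
  have n2 := jacobiError_nonneg β γ n (f₂ f)
  have n3 := jacobiError_nonneg α (γ + 2) n (g₁ f)
  have n4 := jacobiError_nonneg β (γ + 2) n (g₂ f)
  generalize jacobiError α γ n (f₁ f) = e₁ at *
  generalize jacobiError β γ n (f₂ f) = e₂ at *
  generalize jacobiError α (γ + 2) n (g₁ f) = e₃ at *
  generalize jacobiError β (γ + 2) n (g₂ f) = e₄ at *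
  have hs : 0 ≤ Real.sqrt M * (e₁ + e₂) + Real.sqrt M * (e₃ + e₄) := by positivity
  refine le_of_sq_le_sq ?_ hs
  have e : (Real.sqrt M * (e₁ + e₂) + Real.sqrt M * (e₃ + e₄)) ^ 2 =
      M * (e₁ + e₂ + e₃ + e₄) ^ 2 := by
    rw [← mul_add, mul_pow, Real.sq_sqrt hM0.le]
    ring
  rw [e]
  calc _ ≤ M * (e₁ ^ 2 + e₃ ^ 2) + M * (e₂ ^ 2 + e₄ ^ 2) := by
        refine h2.trans ?_
        rw [← mul_assoc, ← mul_assoc (σ * jacobiConst β γ)]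
        gcongr
    _ = M * (e₁ ^ 2 + e₂ ^ 2 + e₃ ^ 2 + e₄ ^ 2) := by ring
    _ ≤ M * (e₁ + e₂ + e₃ + e₄) ^ 2 := by
        -- The errors are nonnegative, so the cross terms of the square can be dropped.
        refine mul_le_mul_of_nonneg_left ?_ hM0.le
        have p1 := mul_nonneg n1 n2
        have p2 := mul_nonneg n1 n3
        have p3 := mul_nonneg n1 n4
        have p4 := mul_nonneg n2 n3
        have p5 := mul_nonneg n2 n4
        have p6 := mul_nonneg n3 n4
        linarith

theorem tendsto_norm_sub_partialSum {f : ℝ → ℝ → ℝ} (hf : MemL2 α β γ f) :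
    Tendsto (fun n : ℕ => norm α β γ σ (fun x y => f x y - partialSum α β γ σ n f x y))
      atTop (𝓝 0) := by
  obtain ⟨c, -, hc⟩ := exists_norm_sub_partialSum_le hα hβ hγ hσ
  have hγ2 : -1 < γ + 2 := by linarith
  have h1 := tendsto_jacobiError hα hγ hf.1
  have h2 := tendsto_jacobiError hβ hγ hf.2
  have h3 := tendsto_jacobiError hα hγ2 (memLp_sub_div_one_sub hα hγ hf.1 (f 1 1))
  have h4 := tendsto_jacobiError hβ hγ2 (memLp_sub_div_one_sub hβ hγ hf.2 (f 1 1))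
  have h := ((h1.add h2).const_mul c).add ((h3.add h4).const_mul c)
  simp only [add_zero, mul_zero] at h
  exact squeeze_zero (fun n => Real.sqrt_nonneg _) (fun n => hc f hf n) h

end

end Wedge

end

theorem theorem2p6 (α β γ σ : ℝ) (hα : -1 < α) (hβ : -1 < β) (hγ : -1 < γ) (hσ : 0 < σ) :
    (∀ f : ℝ → ℝ → ℝ, Wedge.MemL2 α β γ f →
      Tendsto (fun n : ℕ => Wedge.norm α β γ σ
        (fun x y => f x y - Wedge.partialSum α β γ σ n f x y)) atTop (𝓝 0)) ∧
    ∃ c : ℝ, 0 < c ∧ ∀ f : ℝ → ℝ → ℝ, Wedge.MemL2 α β γ f → ∀ n : ℕ,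
      Wedge.norm α β γ σ (fun x y => f x y - Wedge.partialSum α β γ σ n f x y) ≤
        c * (Wedge.jacobiError α γ n (Wedge.f₁ f) + Wedge.jacobiError β γ n (Wedge.f₂ f)) +
        c * (Wedge.jacobiError α (γ + 2) n (Wedge.g₁ f) +
          Wedge.jacobiError β (γ + 2) n (Wedge.g₂ f)) :=
  ⟨fun _ hf => Wedge.tendsto_norm_sub_partialSum hα hβ hγ hσ hf,
    Wedge.exists_norm_sub_partialSum_le hα hβ hγ hσ⟩
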